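/- Let $Q_n$ be the hypercube on $\{0,1\}^n$ (two vectors are adjacent if and only if they differ in exactly one coordinate), and let $C_{r}\times C_{s}$ be the torus, i.e. the Cartesian product of the cycles $C_r$ and $C_s$, where the vertices of $C_m$ are labelled $1,\dots,m$ consecutively around the cycle. An embedding of a graph $G$ into a graph $H$ is a pair $(f,P_f)$, where $f:V(G)\to V(H)$ is injective and $P_f$ assigns to every edge $\{u,v\}\in E(G)$ a path $P_f(u,v)$ in $H$ between $f(u)$ and $f(v)$. Its wirelength is the sum over $\{u,v\}\in E(G)$ of the lengths of the paths $P_f(u,v)$, and $WL(G,H)$ denotes the minimum of the wirelength over all embeddings of $G$ into $H$. Let $\xi_m:\{0,1\}^m\to\{1,\dots,2^m\}$ be the Gray code map, which sends a vector to its position in the binary reflected Gray code: $\xi_0=1$ and, for $w\in\{0,1\}^m$, $\xi_{m+1}(0w)=\xi_m(w)$ and $\xi_{m+1}(1w)=2^{m+1}+1-\xi_m(w)$. For $v=v_1v_2\in\{0,1\}^{n_1+n_2}$ with $v_i\in\{0,1\}^{n_i}$, put $\xi_{n_1n_2}(v)=(\xi_{n_1}(v_1),\xi_{n_2}(v_2))$.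 **Theorem.** Let $n_1,n_2\ge 2$ and $n=n_1+n_2$. Then $$WL(Q_n,C_{2^{n_1}}\times C_{2^{n_2}})=2^{n_2}\left(3\cdot 2^{2n_1-3}-2^{n_1-1}\right)+2^{n_1}\left(3\cdot 2^{2n_2-3}-2^{n_2-1}\right).$$ Moreover, the Gray code embedding is optimal: there are embeddings with vertex map $f=\xi_{n_1n_2}$ that assign to every edge a shortest path of the torus, and each of them has this minimum wirelength. -/

import Mathlib

/-- The hypercube `Q_n`: vertices are the 0-1 vectors of length `n`, and two vectors are adjacent
when they differ in exactly one coordinate. -/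
def hypercube (n : ℕ) : SimpleGraph (Fin n → Bool) where
  Adj u v := hammingDist u v = 1
  symm := ⟨fun u v h => by rw [hammingDist_comm]; exact h⟩
  loopless := ⟨fun u h => by simp at h⟩

instance (n : ℕ) : DecidableRel (hypercube n).Adj :=
  fun u v => inferInstanceAs (Decidable (hammingDist u v = 1))

/-- The torus `C_r × C_s`: the Cartesian (box) product of the cycles of lengths `r` and `s`. -/
abbrev torus (r s : ℕ) : SimpleGraph (Fin r × Fin s) :=
  (SimpleGraph.cycleGraph r).boxProd (SimpleGraph.cycleGraph s)

/-- An embedding of a guest graph `G` into a host graph `H`: an injective map of the vertices,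
together with, for every edge `{u, v}` of `G`, a path in `H` joining the images of `u` and `v`.
Edges are undirected: the path chosen for `(v, u)` is the reverse of the one for `(u, v)`. -/
structure GraphEmbedding {V W : Type*} (G : SimpleGraph V) (H : SimpleGraph W) where
  toFun : V → W
  injective : Function.Injective toFun
  path : ∀ {u v : V}, G.Adj u v → H.Path (toFun u) (toFun v)
  path_symm : ∀ {u v : V} (h : G.Adj u v), path h.symm = (path h).reverse

namespace GraphEmbedding

variable {V W : Type*} {G : SimpleGraph V} {H : SimpleGraph W}

open Classical in
/-- The length of the path assigned to an edge of `G` (and `0` on pairs that are not edges). -/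
noncomputable def edgeLength (E : GraphEmbedding G H) : Sym2 V → ℕ :=
  Sym2.lift ⟨fun u v => if h : G.Adj u v then (E.path h).1.length else 0, by
    intro u v
    dsimp only
    by_cases h : G.Adj u v
    · rw [dif_pos h, dif_pos h.symm, E.path_symm h]
      exact (SimpleGraph.Walk.length_reverse _).symm
    · rw [dif_neg h, dif_neg (fun h' => h h'.symm)]⟩

/-- The wirelength of an embedding: the sum, over all edges of the guest graph, of the lengths of
the paths assigned to them. -/
noncomputable def wirelength [Fintype G.edgeSet] (E : GraphEmbedding G H) : ℕ :=
  ∑ e ∈ G.edgeFinset, E.edgeLength e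

/-- All edges of the guest graph are routed along shortest paths of the host graph. -/
def UsesShortestPaths (E : GraphEmbedding G H) : Prop :=
  ∀ {u v : V} (h : G.Adj u v),
    (E.path h).1.length = H.dist (E.toFun u) (E.toFun v)

end GraphEmbedding

/-- The Gray code map: the position (counted from `0`) of a 0-1 vector in the binary reflected
Gray code. The code on `n + 1` bits lists the code on `n` bits with prefix `0`, followed by the
same list in reverse order with prefix `1`. -/
def grayMap : (n : ℕ) → (Fin n → Bool) → Fin (2 ^ n)
  | 0, _ => 0
  | n + 1, v =>
    let k : Fin (2 ^ (n + 1)) :=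
      Fin.castLE (Nat.pow_le_pow_right Nat.two_pos n.le_succ) (grayMap n (Fin.tail v))
    if v 0 then k.rev else k

/-- The two-component Gray code map: the first `n₁` coordinates and the last `n₂` coordinates are
each mapped by the Gray code map. -/
def grayMap₂ (n₁ n₂ : ℕ) (v : Fin (n₁ + n₂) → Bool) : Fin (2 ^ n₁) × Fin (2 ^ n₂) :=
  (grayMap n₁ (fun i => v (Fin.castAdd n₂ i)), grayMap n₂ (fun j => v (Fin.natAdd n₁ j)))

/-!
The distance in the torus is the sum of the distances in the two cycles, so the wirelength of an
embedding is at least the sum of the costs of the two coordinates of its vertex map, with equality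
for shortest paths. For the Gray code each of these costs is computed by recursion
(`sum_cycDist_grayMap`). The main part is a lower bound for the cost of one coordinate: a map of
`Q_n` to the cycle of length `2 ^ n₁` whose fibres all have `2 ^ n₂` elements
(`sum_cycDist_fiber_ge`).

*Reduction to bijections onto one cycle.* Any set `S` of vertices of the cube can be arranged on a
line with cost at most `|S| (|S| - 1) / 2` (`exists_arrangement`). Opening up every fibre along such
an arrangement, and along its reversal, gives two bijections of `Q_n` onto the cycle of length
`2 ^ n`, whose average cost is at most `2 ^ n₂` times the original cost plus the cost inside the
fibres. The latter is no larger than for the Gray code, whose fibres are subcubes.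

*Bijections onto one cycle* (`sum_cycDist_ge`). Let `n = m + 2` and `K = 2 ^ m`. Cutting the cycle
along its `2 K` antipodal pairs of edges writes the cost as the sum of the edge boundaries of the
sets `A i` of vertices placed on the `i`-th half of the cycle; each contains half of the cube. If
`A` is such a set and `b` is its distance to a facet in a given direction, then the
edge-isoperimetric inequality in that facet and in the opposite one bounds the boundary of `A` below
by `2 K + 2 T(b)`, where `T` is the Takagi function, suitably scaled (`takagi_min_le_edgeBoundary`).
If all the `A i` have boundary at least `3 K`, the bound holds. Otherwise some `A i` is close to a
facet (`exists_near_facet`): this follows from a Poincaré inequality that takes the Fourier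
coefficients of level one into account. Rotating the half cycle by one half turn replaces `A i` by
its complement and hence carries it from near this facet to near the opposite one, in unit steps. So
the distance takes all values in between, which accounts for most of the integral of the Takagi
function. The times left over are compensated by the fact that no `A i` comes closer to a facet than
the starting one, and by an inequality between values and means of the Takagi function
(`takagiSum_le_mul_takagi`); this optimisation is `sum_boundary_path_ge`.
-/

/-! ### The Takagi function -/

/-- An integer version of the Takagi (blancmange) function: `takagi m a` is `2 ^ m` times the
value of the Takagi function at `a / 2 ^ m`, for `a ≤ 2 ^ m`. It is also the number of edges of
`Q_m` that leave an initial segment of length `a` of the binary order. The recursion folds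
`[0, 2 ^ (m + 1)]` at its midpoint. -/
def takagi : ℕ → ℕ → ℕ
  | 0, _ => 0
  | m + 1, a => min a (2 ^ (m + 1) - a) + takagi m (min a (2 ^ (m + 1) - a))

theorem takagi_succ_of_le {m a : ℕ} (h : a ≤ 2 ^ m) : takagi (m + 1) a = a + takagi m a := by
  have h2 : (2 : ℕ) ^ (m + 1) = 2 * 2 ^ m := by ring
  have : min a (2 ^ (m + 1) - a) = a := by omega
  rw [takagi, this]

theorem takagi_symm {m a b : ℕ} (h : a + b = 2 ^ m) : takagi m a = takagi m b := by
  cases m with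
  | zero => rfl
  | succ m =>
    have h1 : min a (2 ^ (m + 1) - a) = min b (2 ^ (m + 1) - b) := by omega
    rw [takagi, takagi, h1]

/-- The midpoint inequality of Boros for the Takagi function, in integer form. It is the inductive
step of the edge-isoperimetric inequality on the cube. -/
theorem takagi_succ_add_le {m s t : ℕ} (hts : t ≤ s) (hs : s ≤ 2 ^ m) :
    takagi (m + 1) (s + t) + t ≤ takagi m s + takagi m t + s := by
  induction m generalizing s t with
  | zero =>
    have hs' : s = 0 ∨ s = 1 := by simp at hs; omega
    have ht' : t = 0 ∨ t = 1 := by simp at hs; omega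
    rcases hs' with rfl | rfl <;> rcases ht' with rfl | rfl <;> simp [takagi] at *
  | succ m ih =>
    have h2 : (2 : ℕ) ^ (m + 1) = 2 * 2 ^ m := by ring
    have h4 : (2 : ℕ) ^ (m + 1 + 1) = 4 * 2 ^ m := by ring
    -- the lower half of the interval, where the recursion does not fold
    have low : ∀ s t, t ≤ s → s ≤ 2 ^ m →
        takagi (m + 1 + 1) (s + t) + t ≤ takagi (m + 1) s + takagi (m + 1) t + s := by
      intro s t hts hs
      have := ih hts hs
      rw [takagi_succ_of_le hs, takagi_succ_of_le (hts.trans hs), takagi_succ_of_le (by omega)]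
      omega
    rcases le_total s (2 ^ m) with h1 | h1
    · exact low s t hts h1
    rcases le_total (2 ^ m) t with h3 | h3
    · have := low (2 ^ (m + 1) - t) (2 ^ (m + 1) - s) (by omega) (by omega)
      rw [takagi_symm (a := s + t) (b := 2 ^ (m + 1) - t + (2 ^ (m + 1) - s)) (by omega),
        takagi_symm (a := s) (b := 2 ^ (m + 1) - s) (by omega),
        takagi_symm (a := t) (b := 2 ^ (m + 1) - t) (by omega)]
      omega
    · -- here the claim reduces to subadditivity of the Takagi function at the previous level
      have subadd : ∀ x y, y ≤ x → x + y ≤ 2 ^ m → takagi m (x + y) ≤ takagi m x + takagi m y := by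
        intro x y hyx hxy
        have := ih hyx (by omega)
        rw [takagi_succ_of_le hxy] at this
        omega
      have diff : ∀ x y, y ≤ x → x ≤ 2 ^ m → takagi m (x - y) ≤ takagi m x + takagi m y := by
        intro x y hyx hx
        have e1 : takagi m (x - y) = takagi m (2 ^ m - x + y) := takagi_symm (by omega)
        have e2 : takagi m x = takagi m (2 ^ m - x) := takagi_symm (by omega)
        rw [e1, e2]
        rcases le_total y (2 ^ m - x) with h | h
        · exact subadd _ _ h (by omega)
        · have := subadd y (2 ^ m - x) h (by omega)
          rw [add_comm (2 ^ m - x)]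
          omega
      have e1 : takagi (m + 1) s = (2 ^ (m + 1) - s) + takagi m (2 ^ (m + 1) - s) := by
        rw [takagi_symm (b := 2 ^ (m + 1) - s) (by omega), takagi_succ_of_le (by omega)]
      rw [e1, takagi_succ_of_le h3]
      rcases le_total t (2 ^ (m + 1) - s) with h | h
      · have := diff _ _ h (by omega)
        rw [takagi_succ_of_le (m := m + 1) (by omega),
          takagi_symm (b := 2 ^ (m + 1) - s - t) (by omega), takagi_succ_of_le (by omega)]
        omega
      · have := diff _ _ h (by omega)
        rw [takagi_symm (b := 2 ^ (m + 1) - (t - (2 ^ (m + 1) - s))) (by omega),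
          takagi_succ_of_le (m := m + 1) (by omega),
          takagi_symm (b := t - (2 ^ (m + 1) - s)) (by omega), takagi_succ_of_le (by omega)]
        omega

/-- On the middle half of the interval the Takagi function is at least `1 / 2`. -/
theorem two_pow_le_two_mul_takagi {m a : ℕ} (h1 : 2 ^ m ≤ 4 * a) (h2 : 4 * a ≤ 3 * 2 ^ m) :
    2 ^ m ≤ 2 * takagi m a := by
  have low : ∀ a, 2 ^ m ≤ 4 * a → 2 * a ≤ 2 ^ m → 2 ^ m ≤ 2 * takagi m a := by
    intro a h1 h2
    match m, h1, h2 with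
    | 0, h1, h2 => simp at h1 h2; omega
    | 1, h1, h2 =>
      have : a = 1 := by omega
      subst this
      simp [takagi]
    | m + 2, h1, h2 =>
      have e1 : (2 : ℕ) ^ (m + 1) = 2 * 2 ^ m := by ring
      have e2 : (2 : ℕ) ^ (m + 2) = 4 * 2 ^ m := by ring
      rw [takagi_succ_of_le (by omega), takagi_symm (b := 2 ^ (m + 1) - a) (by omega),
        takagi_succ_of_le (by omega)]
      omega
  rcases le_total (2 * a) (2 ^ m) with h | h
  · exact low a h1 h
  · rw [takagi_symm (b := 2 ^ m - a) (by omega)]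
    exact low _ (by omega) (by omega)

/-- Twice the trapezoidal sum of the Takagi function over `[0, e]`. -/
def takagiSum (m e : ℕ) : ℕ := ∑ v ∈ Finset.range e, (takagi m v + takagi m (v + 1))

theorem takagiSum_succ (m e : ℕ) :
    takagiSum m (e + 1) = takagiSum m e + (takagi m e + takagi m (e + 1)) :=
  Finset.sum_range_succ _ _

theorem takagiSum_zero (m : ℕ) : takagiSum m 0 = 0 := rfl

theorem takagiSum_level_succ {m e : ℕ} (h : e ≤ 2 ^ m) :
    takagiSum (m + 1) e = e ^ 2 + takagiSum m e := by
  induction e with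
  | zero => rfl
  | succ e ih =>
    rw [takagiSum_succ, takagiSum_succ, ih (by omega), takagi_succ_of_le (by omega),
      takagi_succ_of_le h]
    ring

theorem takagiSum_add_takagiSum_eq {m e e' : ℕ} (h : e + e' = 2 ^ m) :
    takagiSum m (2 ^ m) = takagiSum m e + takagiSum m e' := by
  induction e generalizing e' with
  | zero => rw [takagiSum_zero, ← h]; simp
  | succ e ih =>
    rw [ih (e' := e' + 1) (by omega), takagiSum_succ, takagiSum_succ,
      takagi_symm (a := e) (b := e' + 1) (by omega), takagi_symm (a := e + 1) (b := e') (by omega)]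
    ring

theorem takagiSum_two_pow (m : ℕ) : takagiSum m (2 ^ m) + 2 ^ m = (2 ^ m) ^ 2 := by
  induction m with
  | zero => rfl
  | succ m ih =>
    rw [takagiSum_add_takagiSum_eq (e := 2 ^ m) (e' := 2 ^ m) (by ring),
      takagiSum_level_succ le_rfl]
    have h2 : (2 : ℕ) ^ (m + 1) = 2 * 2 ^ m := by ring
    rw [h2]
    nlinarith

/-- On `[0, 1 / 2]`, the mean of the Takagi function over an initial segment is at most `1 / 2`. -/
theorem takagiSum_le_mul_two_pow {m e : ℕ} (h : 2 * e ≤ 2 ^ m) : takagiSum m e ≤ e * 2 ^ m := by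
  induction m generalizing e with
  | zero =>
    have : e = 0 := by simp at h; omega
    subst this
    simp [takagiSum_zero]
  | succ m ih =>
    have h2 : (2 : ℕ) ^ (m + 1) = 2 * 2 ^ m := by ring
    rcases le_total (2 * e) (2 ^ m) with h1 | h1
    · have := ih h1
      rw [takagiSum_level_succ (by omega), h2]
      nlinarith
    · -- on the second half the integrand is at least `1 / 2`, so the bound propagates downwards
      -- from the midpoint
      have main : ∀ k e, e + k = 2 ^ m → 2 ^ m ≤ 2 * e →
          takagiSum (m + 1) e ≤ e * 2 ^ (m + 1) := by
        intro k
        induction k with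
        | zero =>
          intro e he _
          have h3 := takagiSum_two_pow m
          obtain rfl : e = 2 ^ m := by omega
          rw [takagiSum_level_succ le_rfl, h2]
          nlinarith
        | succ k ihk =>
          intro e he hle
          have h3 := ihk (e + 1) (by omega) (by omega)
          have h4 := two_pow_le_two_mul_takagi (m := m + 1) (a := e) (by omega) (by omega)
          have h5 := two_pow_le_two_mul_takagi (m := m + 1) (a := e + 1) (by omega) (by omega)
          rw [takagiSum_succ] at h3
          rw [add_mul, one_mul] at h3
          omega
      exact main (2 ^ m - e) e (by omega) h1

/-- For `e ≤ d` in the first half of the interval, the mean of the Takagi function over `[0, e]` is at most its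
value at `d`. The Takagi function is not monotone there; this inequality replaces monotonicity. -/
theorem takagiSum_le_mul_takagi {m e d : ℕ} (hed : e ≤ d) (hd : 2 * d ≤ 2 ^ m) :
    takagiSum m e ≤ 2 * e * takagi m d := by
  induction m with
  | zero =>
    have : e = 0 := by simp at hd; omega
    subst this
    simp [takagiSum_zero]
  | succ m ih =>
    have h2 : (2 : ℕ) ^ (m + 1) = 2 * 2 ^ m := by ring
    rcases le_total (2 * d) (2 ^ m) with h1 | h1
    · have := ih h1
      rw [takagiSum_level_succ (by omega), takagi_succ_of_le (by omega)]
      nlinarith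
    · have h3 := two_pow_le_two_mul_takagi (m := m + 1) (a := d) (by omega) (by omega)
      have h4 := takagiSum_le_mul_two_pow (m := m + 1) (e := e) (by omega)
      nlinarith

/-! ### Sums over the edges of the cube -/

/-- The vertex of the cube obtained from `x` by changing coordinate `j`. -/
def flipBit {n : ℕ} (j : Fin n) (x : Fin n → Bool) : Fin n → Bool :=
  Function.update x j (!x j)

section flipBit

variable {n : ℕ}

@[simp]
theorem flipBit_same (j : Fin n) (x : Fin n → Bool) : flipBit j x j = !x j := by
  simp [flipBit]

theorem flipBit_ne {i j : Fin n} (h : i ≠ j) (x : Fin n → Bool) : flipBit j x i = x i := by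
  simp [flipBit, h]

theorem flipBit_insertNth_same (p : Fin (n + 1)) (b : Bool) (y : Fin n → Bool) :
    flipBit p (p.insertNth b y : Fin (n + 1) → Bool) = p.insertNth (!b) y := by
  rw [Fin.eq_insertNth_iff]
  refine ⟨by simp, ?_⟩
  ext k
  simp [Fin.removeNth, flipBit_ne (Fin.succAbove_ne p k)]

theorem flipBit_insertNth_succAbove (p : Fin (n + 1)) (j : Fin n) (b : Bool) (y : Fin n → Bool) :
    flipBit (p.succAbove j) (p.insertNth b y : Fin (n + 1) → Bool) =
      p.insertNth b (flipBit j y) := by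
  rw [Fin.eq_insertNth_iff]
  refine ⟨by simp [flipBit_ne (Fin.succAbove_ne p j).symm], ?_⟩
  ext k
  by_cases h : k = j
  · subst h
    simp [Fin.removeNth]
  · have : p.succAbove k ≠ p.succAbove j := fun h' => h (Fin.succAbove_right_injective h')
    simp [Fin.removeNth, flipBit_ne h, flipBit_ne this]

end flipBit

section sums

variable {n : ℕ} {M : Type*} [AddCommMonoid M]

theorem sum_insertNth (p : Fin (n + 1)) (c : (Fin (n + 1) → Bool) → M) :
    ∑ x, c x = ∑ y : Fin n → Bool, (c (p.insertNth false y) + c (p.insertNth true y)) := by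
  rw [← (Fin.insertNthEquiv (fun _ => Bool) p).sum_comp, Fintype.sum_prod_type,
    Fintype.sum_bool, add_comm, ← Finset.sum_add_distrib]
  rfl

/-- Splitting a sum over the (ordered) edges of the cube along a coordinate `p`: the edges in
direction `p`, and the edges inside the two facets. -/
theorem sum_flipBit_insertNth (p : Fin (n + 1))
    (c : (Fin (n + 1) → Bool) → (Fin (n + 1) → Bool) → M) :
    ∑ x, ∑ j, c x (flipBit j x) =
      (∑ y : Fin n → Bool, (c (p.insertNth false y) (p.insertNth true y) +
        c (p.insertNth true y) (p.insertNth false y))) +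
      ((∑ y : Fin n → Bool, ∑ j, c (p.insertNth false y) (p.insertNth false (flipBit j y))) +
       ∑ y : Fin n → Bool, ∑ j, c (p.insertNth true y) (p.insertNth true (flipBit j y))) := by
  rw [sum_insertNth p]
  simp only [Fin.sum_univ_succAbove _ p, flipBit_insertNth_same, flipBit_insertNth_succAbove,
    Bool.not_false, Bool.not_true]
  rw [← Finset.sum_add_distrib, ← Finset.sum_add_distrib]
  refine Finset.sum_congr rfl fun y _ => ?_
  abel

end sums

/-! ### The edge-isoperimetric inequality -/

/-- Twice the size of the edge boundary of a set `S` of vertices of the cube: the number of ordered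
edges with exactly one end in `S`. -/
def edgeBoundary {n : ℕ} (S : Finset (Fin n → Bool)) : ℕ :=
  ∑ x, ∑ j, if (x ∈ S ↔ flipBit j x ∈ S) then 0 else 1

/-- The part of `S` in the facet `x p = b`, as a set of vertices of the smaller cube. -/
def facet {n : ℕ} (p : Fin (n + 1)) (b : Bool) (S : Finset (Fin (n + 1) → Bool)) :
    Finset (Fin n → Bool) :=
  Finset.univ.filter fun y => p.insertNth b y ∈ S

section boundary

variable {n : ℕ}

@[simp]
theorem mem_facet {p : Fin (n + 1)} {b : Bool} {S : Finset (Fin (n + 1) → Bool)}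
    {y : Fin n → Bool} : y ∈ facet p b S ↔ p.insertNth b y ∈ S := by
  simp [facet]

theorem card_facet_add_card_facet (p : Fin (n + 1)) (S : Finset (Fin (n + 1) → Bool)) :
    (facet p false S).card + (facet p true S).card = S.card := by
  have h : S.card = ∑ x, if x ∈ S then 1 else 0 := by simp
  rw [h, sum_insertNth p, Finset.sum_add_distrib, facet, facet, Finset.card_filter,
    Finset.card_filter]

theorem card_facet_true (p : Fin (n + 1)) (S : Finset (Fin (n + 1) → Bool)) :
    (facet p true S).card = (S.filter fun x => x p = true).card := by
  have h : S.filter (fun x => x p = true) = Finset.univ.filter (fun x => x ∈ S ∧ x p = true) := by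
    ext; simp
  rw [h, Finset.card_filter, sum_insertNth p, facet, Finset.card_filter]
  simp

/-- The number of edges in direction `p` between `S` and its complement. -/
def crossing (p : Fin n) (S : Finset (Fin n → Bool)) : ℕ :=
  ∑ x, if (x ∈ S ↔ flipBit p x ∈ S) then 0 else 1

theorem edgeBoundary_eq_sum_crossing (S : Finset (Fin n → Bool)) :
    edgeBoundary S = ∑ p, crossing p S :=
  Finset.sum_comm

theorem two_mul_card_facet_le (p : Fin (n + 1)) (S : Finset (Fin (n + 1) → Bool)) :
    2 * (facet p true S).card ≤ 2 * (facet p false S).card + crossing p S ∧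
      2 * (facet p false S).card ≤ 2 * (facet p true S).card + crossing p S := by
  rw [crossing, sum_insertNth p, facet, facet, Finset.card_filter, Finset.card_filter,
    Finset.mul_sum, Finset.mul_sum, ← Finset.sum_add_distrib, ← Finset.sum_add_distrib]
  simp only [flipBit_insertNth_same, Bool.not_false, Bool.not_true]
  constructor <;> refine Finset.sum_le_sum fun y _ => ?_ <;>
    by_cases h1 : (p.insertNth true y : Fin (n + 1) → Bool) ∈ S <;>
    by_cases h2 : (p.insertNth false y : Fin (n + 1) → Bool) ∈ S <;> simp [h1, h2]

theorem edgeBoundary_eq_facet (p : Fin (n + 1)) (S : Finset (Fin (n + 1) → Bool)) :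
    edgeBoundary S =
      crossing p S + (edgeBoundary (facet p false S) + edgeBoundary (facet p true S)) := by
  rw [edgeBoundary, sum_flipBit_insertNth p fun x y => if (x ∈ S ↔ y ∈ S) then 0 else 1,
    crossing, sum_insertNth p]
  simp only [flipBit_insertNth_same, Bool.not_false, Bool.not_true, edgeBoundary, mem_facet]

theorem card_le_two_pow (S : Finset (Fin n → Bool)) : S.card ≤ 2 ^ n := by
  have := S.card_le_univ
  simpa using this

/-- The edge-isoperimetric inequality on the cube (Harper). -/
theorem two_mul_takagi_card_le_edgeBoundary (S : Finset (Fin n → Bool)) :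
    2 * takagi n S.card ≤ edgeBoundary S := by
  induction n with
  | zero => simp [takagi]
  | succ n ih =>
    have h0 := ih (facet 0 false S)
    have h1 := ih (facet 0 true S)
    have hc := card_facet_add_card_facet 0 S
    obtain ⟨h2, h3⟩ := two_mul_card_facet_le 0 S
    have hb0 := card_le_two_pow (facet 0 false S)
    have hb1 := card_le_two_pow (facet 0 true S)
    rw [edgeBoundary_eq_facet 0, ← hc]
    rcases le_total (facet 0 true S).card (facet 0 false S).card with h | h
    · have := takagi_succ_add_le h hb0
      omega
    · have := takagi_succ_add_le h hb1
      rw [add_comm (facet 0 false S).card]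
      omega

/-- The boundary of a set containing half of the vertices is bounded below by a Takagi function of
its distance `min a (2 ^ (m + 1) - a)` to a facet in direction `p`, where `a` is the number of its
elements with `x p = true`. -/
theorem takagi_min_le_edgeBoundary {m : ℕ} (p : Fin (m + 2)) (S : Finset (Fin (m + 2) → Bool))
    (hS : S.card = 2 ^ (m + 1)) :
    4 * 2 ^ m + 4 * takagi m (min (S.filter fun x => x p = true).card
      (2 ^ (m + 1) - (S.filter fun x => x p = true).card)) ≤ edgeBoundary S := by
  have h0 := two_mul_takagi_card_le_edgeBoundary (facet p false S)
  have h1 := two_mul_takagi_card_le_edgeBoundary (facet p true S)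
  have hc := card_facet_add_card_facet p S
  obtain ⟨h2, h3⟩ := two_mul_card_facet_le p S
  rw [edgeBoundary_eq_facet p, ← card_facet_true]
  have e : (2 : ℕ) ^ (m + 1) = 2 * 2 ^ m := by ring
  rw [takagi_symm (b := (facet p true S).card) (by omega), takagi] at h0
  rw [takagi] at h1
  omega

end boundary

/-! ### Level-one Fourier coefficients and sets near a facet -/

section fourier

variable {n : ℕ}

/-- The Dirichlet form on the cube (over ordered edges). -/
def dirichletForm (f : (Fin n → Bool) → ℤ) : ℤ := ∑ x, ∑ j, (f x - f (flipBit j x)) ^ 2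

/-- The unnormalised Fourier coefficient of `f` at the coordinate `j`. -/
def dictatorCoeff (j : Fin n) (f : (Fin n → Bool) → ℤ) : ℤ :=
  ∑ x, if x j then f x else -f x

theorem dirichletForm_nonneg (f : (Fin n → Bool) → ℤ) : 0 ≤ dirichletForm f :=
  Finset.sum_nonneg fun _ _ => Finset.sum_nonneg fun _ _ => sq_nonneg _

theorem dirichletForm_split (f : (Fin (n + 1) → Bool) → ℤ) :
    2 * dirichletForm f =
      4 * ∑ y, (f (Fin.insertNth 0 true y) - f (Fin.insertNth 0 false y)) ^ 2 +
      (dirichletForm (fun y => f (Fin.insertNth 0 true y) + f (Fin.insertNth 0 false y)) +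
       dirichletForm (fun y => f (Fin.insertNth 0 true y) - f (Fin.insertNth 0 false y))) := by
  rw [dirichletForm, sum_flipBit_insertNth 0 fun x y => (f x - f y) ^ 2, dirichletForm,
    dirichletForm]
  simp only [mul_add, Finset.mul_sum, ← Finset.sum_add_distrib]
  refine Finset.sum_congr rfl fun y _ => ?_
  congr 1
  · ring
  · refine Finset.sum_congr rfl fun j _ => ?_
    ring

theorem sum_sq_split (f : (Fin (n + 1) → Bool) → ℤ) :
    2 * ∑ x, f x ^ 2 =
      ∑ y, (f (Fin.insertNth 0 true y) + f (Fin.insertNth 0 false y)) ^ 2 +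
      ∑ y, (f (Fin.insertNth 0 true y) - f (Fin.insertNth 0 false y)) ^ 2 := by
  rw [sum_insertNth 0, Finset.mul_sum, ← Finset.sum_add_distrib]
  refine Finset.sum_congr rfl fun y _ => ?_
  ring

theorem sum_split (f : (Fin (n + 1) → Bool) → ℤ) :
    ∑ x, f x = ∑ y, (f (Fin.insertNth 0 true y) + f (Fin.insertNth 0 false y)) := by
  rw [sum_insertNth 0]
  exact Finset.sum_congr rfl fun y _ => add_comm _ _

theorem dictatorCoeff_zero (f : (Fin (n + 1) → Bool) → ℤ) :
    dictatorCoeff 0 f = ∑ y, (f (Fin.insertNth 0 true y) - f (Fin.insertNth 0 false y)) := by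
  rw [dictatorCoeff, sum_insertNth 0]
  refine Finset.sum_congr rfl fun y _ => ?_
  simp [-Fin.insertNth_zero', Fin.insertNth_apply_same]
  ring

theorem dictatorCoeff_succ (j : Fin n) (f : (Fin (n + 1) → Bool) → ℤ) :
    dictatorCoeff j.succ f =
      dictatorCoeff j (fun y => f (Fin.insertNth 0 true y) + f (Fin.insertNth 0 false y)) := by
  rw [dictatorCoeff, sum_insertNth 0, dictatorCoeff]
  refine Finset.sum_congr rfl fun y _ => ?_
  by_cases h : y j <;> simp [h]
  ring

/-- The Poincaré inequality on the cube. -/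
theorem poincare_le (f : (Fin n → Bool) → ℤ) :
    4 * (2 ^ n * ∑ x, f x ^ 2 - (∑ x, f x) ^ 2) ≤ 2 ^ n * dirichletForm f := by
  induction n with
  | zero => simp [dirichletForm]
  | succ n ih =>
    have h1 := ih (fun y => f (Fin.insertNth 0 true y) + f (Fin.insertNth 0 false y))
    have h2 := dirichletForm_nonneg
      (fun y => f (Fin.insertNth 0 true y) - f (Fin.insertNth 0 false y))
    have h3 : (0 : ℤ) ≤ 2 ^ n := by positivity
    have h4 := mul_nonneg h3 h2
    have h5 := congrArg (fun t : ℤ => 2 ^ n * t) (dirichletForm_split f)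
    have h6 := congrArg (fun t : ℤ => 2 ^ n * t) (sum_sq_split f)
    rw [sum_split f, pow_succ]
    simp only [mul_add] at h5 h6
    linarith

/-- A refinement of the Poincaré inequality by the coefficients of level one: the part of `f` on
Fourier levels at least two contributes to the Dirichlet form with weight at least two. -/
theorem level_two_le (f : (Fin n → Bool) → ℤ) :
    4 * (2 * (2 ^ n * ∑ x, f x ^ 2 - (∑ x, f x) ^ 2) - ∑ j, dictatorCoeff j f ^ 2) ≤
      2 ^ n * dirichletForm f := by
  induction n with
  | zero => simp [dirichletForm]
  | succ n ih =>
    have h1 := ih (fun y => f (Fin.insertNth 0 true y) + f (Fin.insertNth 0 false y))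
    have h2 := poincare_le (fun y => f (Fin.insertNth 0 true y) - f (Fin.insertNth 0 false y))
    have h5 := congrArg (fun t : ℤ => 2 ^ n * t) (dirichletForm_split f)
    have h6 := congrArg (fun t : ℤ => 2 ^ n * t) (sum_sq_split f)
    simp only [Fin.sum_univ_succ, dictatorCoeff_zero, dictatorCoeff_succ]
    rw [sum_split f, pow_succ]
    simp only [mul_add] at h5 h6
    linarith

end fourier

section balanced

variable {m : ℕ} (S : Finset (Fin (m + 2) → Bool))

theorem dictatorCoeff_indicator (hS : S.card = 2 ^ (m + 1)) (p : Fin (m + 2)) :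
    dictatorCoeff p (fun x => if x ∈ S then 1 else -1) =
      4 * ((S.filter fun x => x p = true).card - 2 ^ m) := by
  have h1 : ∑ x : Fin (m + 2) → Bool, (if x p then 1 else -1 : ℤ) = 0 := by
    rw [sum_insertNth p]
    simp
  have h2 : ∑ x, (if x ∈ S then 1 else 0 : ℤ) = S.card := by simp
  have h3 : ∑ x, (if x ∈ S ∧ x p = true then 1 else 0 : ℤ) =
      (S.filter fun x => x p = true).card := by
    rw [Finset.sum_boole]
    congr 2
    ext
    simp
  have h4 : dictatorCoeff p (fun x => if x ∈ S then 1 else -1) =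
      ∑ x, (4 * (if x ∈ S ∧ x p = true then 1 else 0 : ℤ) - 2 * (if x ∈ S then 1 else 0 : ℤ) -
        (if x p then 1 else -1 : ℤ)) := by
    refine Finset.sum_congr rfl fun x _ => ?_
    by_cases hx : x ∈ S <;> by_cases hp : x p = true <;> simp [hx, hp]
  rw [h4, Finset.sum_sub_distrib, Finset.sum_sub_distrib, ← Finset.mul_sum, ← Finset.mul_sum, h1,
    h2, h3, hS]
  push_cast
  ring

theorem dirichletForm_indicator {n : ℕ} (S : Finset (Fin n → Bool)) :
    dirichletForm (fun x => if x ∈ S then 1 else -1) = 4 * edgeBoundary S := by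
  rw [edgeBoundary, dirichletForm]
  push_cast
  rw [Finset.mul_sum]
  refine Finset.sum_congr rfl fun x _ => ?_
  rw [Finset.mul_sum]
  refine Finset.sum_congr rfl fun j _ => ?_
  by_cases h1 : x ∈ S <;> by_cases h2 : flipBit j x ∈ S <;> simp [h1, h2]

/-- A set containing half of the vertices whose boundary is less than `3 / 2` times the minimum is
close to a facet of the cube. The isoperimetric inequality excludes intermediate distances in
every direction; if the distance were large in all directions, then all level-one Fourier
coefficients would be small, and `level_two_le` would force a large boundary. -/
theorem exists_near_facet (hS : S.card = 2 ^ (m + 1)) (hB : edgeBoundary S < 6 * 2 ^ m) :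
    ∃ p, 4 * min (S.filter fun x => x p = true).card
      (2 ^ (m + 1) - (S.filter fun x => x p = true).card) < 2 ^ m := by
  by_contra! hfar
  have e : (2 : ℕ) ^ (m + 1) = 2 * 2 ^ m := by ring
  have hdir : ∀ p, 16 * (((S.filter fun x => x p = true).card : ℤ) - 2 ^ m) ^ 2 ≤
      2 ^ m * crossing p S := by
    intro p
    have h1 := hfar p
    have h2 := takagi_min_le_edgeBoundary p S hS
    have hle : (S.filter fun x => x p = true).card ≤ 2 ^ (m + 1) :=
      hS ▸ Finset.card_filter_le _ _
    have h3 : 3 * 2 ^ m < 4 * min (S.filter fun x => x p = true).card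
        (2 ^ (m + 1) - (S.filter fun x => x p = true).card) := by
      by_contra! h3
      have := two_pow_le_two_mul_takagi h1 h3
      omega
    have h4 := card_facet_add_card_facet p S
    obtain ⟨h5, h6⟩ := two_mul_card_facet_le p S
    rw [card_facet_true] at h4 h5 h6
    rw [hS] at h4
    generalize (S.filter fun x => x p = true).card = a at *
    have e' : ((2 : ℤ) ^ m) = ((2 ^ m : ℕ) : ℤ) := by push_cast; rfl
    rw [e']
    have h7 : 4 * |(a : ℤ) - (2 ^ m : ℕ)| ≤ (2 ^ m : ℕ) := by
      rw [← abs_of_pos (show (0 : ℤ) < 4 by norm_num), ← abs_mul, abs_le]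
      omega
    have h8 : 4 * |(a : ℤ) - (2 ^ m : ℕ)| ≤ crossing p S := by
      rw [← abs_of_pos (show (0 : ℤ) < 4 by norm_num), ← abs_mul, abs_le]
      omega
    have h9 := mul_le_mul h7 h8 (by positivity) (by positivity)
    calc _ = 4 * |(a : ℤ) - (2 ^ m : ℕ)| * (4 * |(a : ℤ) - (2 ^ m : ℕ)|) := by
          rw [← sq_abs]; ring
      _ ≤ _ := h9
  have hsum := Finset.sum_le_sum fun p (_ : p ∈ Finset.univ) => hdir p
  rw [← Finset.mul_sum, ← Finset.mul_sum, ← Nat.cast_sum, ← edgeBoundary_eq_sum_crossing] at hsum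
  have hl := level_two_le (fun x => if x ∈ S then (1 : ℤ) else -1)
  have hmean : ∑ x, (if x ∈ S then (1 : ℤ) else -1) = 0 := by
    have h1 : ∑ x, (if x ∈ S then (1 : ℤ) else -1) = ∑ x, (2 * (if x ∈ S then 1 else 0) - 1) :=
      Finset.sum_congr rfl fun x _ => by split_ifs <;> rfl
    rw [h1, Finset.sum_sub_distrib, ← Finset.mul_sum]
    simp [hS]
    ring
  have hsq : ∑ x, (if x ∈ S then (1 : ℤ) else -1) ^ 2 = 2 ^ (m + 2) := by simp [ite_pow]
  simp only [dictatorCoeff_indicator S hS, dirichletForm_indicator, hmean, hsq, mul_pow,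
    ← Finset.mul_sum] at hl
  have hB' : (edgeBoundary S : ℤ) < 6 * 2 ^ m := by exact_mod_cast hB
  have hK : (0 : ℤ) < 2 ^ m := by positivity
  rw [show (2 : ℤ) ^ (m + 2) = 4 * 2 ^ m by ring] at hl
  nlinarith [mul_lt_mul_of_pos_left hB' hK]

end balanced

/-! ### Bijections of the cube onto a cycle -/

/-- The distance of `x` and `y` on the cycle `0, 1, …, N - 1`, for `x, y < N`. -/
def cycDist (N x y : ℕ) : ℕ := min (Nat.dist x y) (N - Nat.dist x y)

section sequences

/-- A discrete intermediate value theorem. -/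
theorem exists_eq_of_le_of_lt_of_step {u : ℕ → ℕ} (hu : ∀ i, u (i + 1) ≤ u i + 1) {i L v : ℕ}
    (h1 : u i ≤ v) (h2 : v < u (i + L)) : ∃ t, i ≤ t ∧ t < i + L ∧ u t = v := by
  induction L with
  | zero => rw [add_zero] at h2; omega
  | succ L ih =>
    by_cases h : v < u (i + L)
    · obtain ⟨t, ht⟩ := ih h
      exact ⟨t, by omega⟩
    · have h3 := hu (i + L)
      rw [← add_assoc] at h2
      exact ⟨i + L, by omega⟩

theorem sum_Ico_eq_sum_range_of_periodic {φ : ℕ → ℕ} {L : ℕ} (hφ : ∀ i, φ (i + L) = φ i) (c : ℕ) :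
    ∑ i ∈ Finset.Ico c (c + L), φ i = ∑ i ∈ Finset.range L, φ i := by
  induction c with
  | zero => simp
  | succ c ih =>
    rw [← ih]
    rcases L.eq_zero_or_pos with rfl | hL
    · simp
    rw [Finset.sum_eq_sum_Ico_succ_bot (show c < c + L by omega),
      show c + 1 + L = c + L + 1 by ring, Finset.sum_Ico_succ_top (by omega), hφ, add_comm]

theorem sum_takagi_Ico {m k : ℕ} (hk : k ≤ 2 ^ m) :
    ∑ v ∈ Finset.Ico (2 ^ m - k) (2 ^ m + k), takagi m (min v (2 ^ (m + 1) - v)) +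
      takagiSum m (2 ^ m - k) = takagiSum m (2 ^ m) := by
  have e : (2 : ℕ) ^ (m + 1) = 2 * 2 ^ m := by ring
  induction k with
  | zero => simp
  | succ k ih =>
    rw [← ih (by omega), Finset.sum_eq_sum_Ico_succ_bot (by omega),
      show 2 ^ m - (k + 1) + 1 = 2 ^ m - k by omega, ← add_assoc,
      Finset.sum_Ico_succ_top (by omega),
      show 2 ^ m - k = 2 ^ m - (k + 1) + 1 by omega, takagiSum_succ,
      show min (2 ^ m - (k + 1)) (2 ^ (m + 1) - (2 ^ m - (k + 1))) = 2 ^ m - (k + 1) by omega,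
      show min (2 ^ m + k) (2 ^ (m + 1) - (2 ^ m + k)) = 2 ^ m - (k + 1) + 1 by omega]
    ring

/-- The optimisation over closed paths. Here `φ i` plays the role of the boundary of the `i`-th
half-turn set and `a j i` of the number of its elements with `x j = true`. Let `ε` be the smallest
distance of any of these sets to a facet. If it is attained in direction `j`, then `a j` increases
from `ε` to `2 ^ (m + 1) - ε` in unit steps during `2 ^ (m + 1)` steps, so that it takes each
value in between, and only `2 * ε` of the times are not accounted for. At these the boundary is at
least the mean of the missing values, by `takagiSum_le_mul_takagi`. -/
theorem sum_boundary_path_ge {ι : Type*} {m : ℕ} {φ : ℕ → ℕ} {a : ι → ℕ → ℕ}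
    (hφ : ∀ i, φ (i + 2 ^ (m + 1)) = φ i)
    (ha : ∀ j i, a j (i + 2 ^ (m + 1)) + a j i = 2 ^ (m + 1))
    (hstep : ∀ j i, a j (i + 1) ≤ a j i + 1)
    (hT : ∀ j i, 4 * 2 ^ m + 4 * takagi m (min (a j i) (2 ^ (m + 1) - a j i)) ≤ φ i)
    (hnear : ∀ i, φ i < 6 * 2 ^ m → ∃ j, 4 * min (a j i) (2 ^ (m + 1) - a j i) < 2 ^ m) :
    12 * (2 ^ m) ^ 2 ≤ ∑ i ∈ Finset.range (2 ^ (m + 1)), φ i + 4 * 2 ^ m := by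
  have e : (2 : ℕ) ^ (m + 1) = 2 * 2 ^ m := by ring
  by_cases hall : ∀ i, 6 * 2 ^ m ≤ φ i
  · have := Finset.card_nsmul_le_sum (Finset.range (2 ^ (m + 1))) φ _ fun i _ => hall i
    have h1 : 2 ^ (m + 1) * (6 * 2 ^ m) = 12 * (2 ^ m) ^ 2 := by rw [e]; ring
    rw [Finset.card_range, smul_eq_mul, h1] at this
    exact this.trans (Nat.le_add_right _ _)
  push Not at hall
  obtain ⟨i₁, hi₁⟩ := hall
  classical
  obtain ⟨j₁, hj₁⟩ := hnear i₁ hi₁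
  -- the minimal distance `ε` to a facet, over all times and directions
  have hex : ∃ ε, ∃ i j, min (a j i) (2 ^ (m + 1) - a j i) = ε := ⟨_, i₁, j₁, rfl⟩
  obtain ⟨ε, ⟨i₂, j, hij⟩, hmin⟩ : ∃ ε, (∃ i j, min (a j i) (2 ^ (m + 1) - a j i) = ε) ∧
      ∀ i j, ε ≤ min (a j i) (2 ^ (m + 1) - a j i) :=
    ⟨Nat.find hex, Nat.find_spec hex, fun i j => Nat.find_min' hex ⟨i, j, rfl⟩⟩
  have hε : 4 * ε < 2 ^ m := by have := hmin i₁ j₁; omega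
  obtain ⟨i₀, hi₀⟩ : ∃ i₀, a j i₀ = ε := by
    have := ha j i₂
    rcases le_total (a j i₂) (2 ^ (m + 1) - a j i₂) with h | h
    · exact ⟨i₂, by omega⟩
    · exact ⟨i₂ + 2 ^ (m + 1), by omega⟩
  have hend : a j (i₀ + 2 ^ (m + 1)) = 2 ^ (m + 1) - ε := by have := ha j i₀; omega
  -- a bound valid at all times
  have hany : ∀ i, 2 * ε * (4 * 2 ^ m) + 4 * takagiSum m ε ≤ 2 * ε * φ i := by
    intro i
    by_cases h : 6 * 2 ^ m ≤ φ i
    · have := takagiSum_le_mul_two_pow (m := m) (e := ε) (by omega)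
      nlinarith
    · obtain ⟨j', hj'⟩ := hnear i (by omega)
      have h1 := takagiSum_le_mul_takagi (m := m) (hmin i j') (by omega)
      have h2 := Nat.mul_le_mul_left (2 * ε) (hT j' i)
      nlinarith
  -- the times at which `a j` takes the intermediate values
  have htimes : ∀ v, ∃ t, v ∈ Finset.Ico ε (2 ^ (m + 1) - ε) →
      t ∈ Finset.Ico i₀ (i₀ + 2 ^ (m + 1)) ∧ a j t = v := by
    intro v
    by_cases hv : v ∈ Finset.Ico ε (2 ^ (m + 1) - ε)
    · rw [Finset.mem_Ico] at hv
      obtain ⟨t, h1, h2, h3⟩ := exists_eq_of_le_of_lt_of_step (hstep j) (i := i₀)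
        (L := 2 ^ (m + 1)) (v := v) (by omega) (by omega)
      exact ⟨t, fun _ => ⟨Finset.mem_Ico.2 ⟨h1, h2⟩, h3⟩⟩
    · exact ⟨0, fun h => absurd h hv⟩
  choose t ht using htimes
  have hinj : Set.InjOn t (Finset.Ico ε (2 ^ (m + 1) - ε) : Finset ℕ) := by
    intro v hv w hw hvw
    rw [← (ht v hv).2, ← (ht w hw).2, hvw]
  set R := (Finset.Ico ε (2 ^ (m + 1) - ε)).image t with hR
  have hsub : R ⊆ Finset.Ico i₀ (i₀ + 2 ^ (m + 1)) := by
    intro i hi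
    obtain ⟨v, hv, rfl⟩ := Finset.mem_image.1 hi
    exact (ht v hv).1
  have hcardR : R.card = 2 ^ (m + 1) - ε - ε := by
    rw [hR, Finset.card_image_of_injOn hinj, Nat.card_Ico]
  have hcard : (Finset.Ico i₀ (i₀ + 2 ^ (m + 1)) \ R).card = 2 * ε := by
    rw [Finset.card_sdiff_of_subset hsub, hcardR, Nat.card_Ico]
    omega
  have hpath : (2 ^ (m + 1) - ε - ε) * (4 * 2 ^ m) + 4 * takagiSum m (2 ^ m) ≤
      ∑ i ∈ R, φ i + 4 * takagiSum m ε := by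
    have h1 := sum_takagi_Ico (m := m) (k := 2 ^ m - ε) (by omega)
    rw [show 2 ^ m - (2 ^ m - ε) = ε by omega,
      show 2 ^ m + (2 ^ m - ε) = 2 ^ (m + 1) - ε by omega] at h1
    have h2 : ∑ v ∈ Finset.Ico ε (2 ^ (m + 1) - ε),
        (4 * 2 ^ m + 4 * takagi m (min v (2 ^ (m + 1) - v))) ≤ ∑ i ∈ R, φ i := by
      rw [hR, Finset.sum_image hinj]
      refine Finset.sum_le_sum fun v hv => ?_
      have := hT j (t v)
      rwa [(ht v hv).2] at this
    rw [Finset.sum_add_distrib, Finset.sum_const, Nat.card_Ico, smul_eq_mul, ← Finset.mul_sum] at h2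
    omega
  have hrest : 2 * ε * (4 * 2 ^ m) + 4 * takagiSum m ε ≤
      ∑ i ∈ Finset.Ico i₀ (i₀ + 2 ^ (m + 1)) \ R, φ i := by
    rcases ε.eq_zero_or_pos with h0 | h0
    · simp [h0, takagiSum_zero]
    · have h1 := Finset.card_nsmul_le_sum _ _ _
        fun i (_ : i ∈ Finset.Ico i₀ (i₀ + 2 ^ (m + 1)) \ R) => hany i
      rw [hcard, smul_eq_mul, ← Finset.mul_sum] at h1
      exact Nat.le_of_mul_le_mul_left h1 (by omega)
  have htot := takagiSum_two_pow m
  rw [← sum_Ico_eq_sum_range_of_periodic hφ i₀, ← Finset.sum_sdiff hsub]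
  have h1 : (2 ^ (m + 1) - ε - ε) * (4 * 2 ^ m) + 2 * ε * (4 * 2 ^ m) = 8 * (2 ^ m) ^ 2 := by
    rw [← add_mul, show 2 ^ (m + 1) - ε - ε + 2 * ε = 2 * 2 ^ m by omega]
    ring
  omega

end sequences

section rotation

theorem card_filter_threshold {L p q : ℕ} (hp : p ≤ L) (hq : q ≤ L) :
    ((Finset.range L).filter fun i => ¬(i < p ↔ i < q)).card = (p - q) + (q - p) := by
  have : (Finset.range L).filter (fun i => ¬(i < p ↔ i < q)) = Finset.Ico (min p q) (max p q) := by
    ext i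
    simp only [Finset.mem_filter, Finset.mem_range, Finset.mem_Ico]
    omega
  rw [this, Nat.card_Ico]
  omega

theorem add_mod_lt_half {L x i : ℕ} (hx : x < 2 * L) (hi : i < L) :
    (x + i) % (2 * L) < L ↔ (x < L ∧ i < L - x) ∨ (L ≤ x ∧ ¬ i < 2 * L - x) := by
  rw [Nat.add_mod_eq_ite, Nat.mod_eq_of_lt hx, Nat.mod_eq_of_lt (by omega : i < 2 * L)]
  split_ifs <;> omega

/-- The cyclic distance counts the antipodal cuts of the cycle that separate the two points. -/
theorem cycDist_eq_sum {L x y : ℕ} (hx : x < 2 * L) (hy : y < 2 * L) :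
    cycDist (2 * L) x y = ∑ i ∈ Finset.range L,
      if ((x + i) % (2 * L) < L ↔ (y + i) % (2 * L) < L) then 0 else 1 := by
  have h1 : ∑ i ∈ Finset.range L,
      (if ((x + i) % (2 * L) < L ↔ (y + i) % (2 * L) < L) then 0 else 1) =
      ((Finset.range L).filter
        fun i => ¬((x + i) % (2 * L) < L ↔ (y + i) % (2 * L) < L)).card := by
    rw [Finset.card_filter]
    refine Finset.sum_congr rfl fun i _ => ?_
    by_cases h : ((x + i) % (2 * L) < L ↔ (y + i) % (2 * L) < L) <;> simp [h]
  rw [h1, cycDist, Nat.dist]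
  have h2 : ∀ p q, p ≤ L → q ≤ L →
      ((Finset.range L).filter fun i => (i < p ↔ i < q)).card = L - ((p - q) + (q - p)) := by
    intro p q hp hq
    have := Finset.card_filter_add_card_filter_not (s := Finset.range L) fun i => (i < p ↔ i < q)
    rw [card_filter_threshold hp hq, Finset.card_range] at this
    omega
  rcases lt_or_ge x L with hx' | hx' <;> rcases lt_or_ge y L with hy' | hy'
  · rw [Finset.filter_congr (q := fun i => ¬(i < L - x ↔ i < L - y)),
      card_filter_threshold (by omega) (by omega)]
    · omega
    · intro i hi
      rw [Finset.mem_range] at hi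
      rw [add_mod_lt_half hx hi, add_mod_lt_half hy hi]
      omega
  · rw [Finset.filter_congr (q := fun i => (i < L - x ↔ i < 2 * L - y)),
      h2 _ _ (by omega) (by omega)]
    · omega
    · intro i hi
      rw [Finset.mem_range] at hi
      rw [add_mod_lt_half hx hi, add_mod_lt_half hy hi]
      omega
  · rw [Finset.filter_congr (q := fun i => (i < 2 * L - x ↔ i < L - y)),
      h2 _ _ (by omega) (by omega)]
    · omega
    · intro i hi
      rw [Finset.mem_range] at hi
      rw [add_mod_lt_half hx hi, add_mod_lt_half hy hi]
      omega
  · rw [Finset.filter_congr (q := fun i => ¬(i < 2 * L - x ↔ i < 2 * L - y)),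
      card_filter_threshold (by omega) (by omega)]
    · omega
    · intro i hi
      rw [Finset.mem_range] at hi
      rw [add_mod_lt_half hx hi, add_mod_lt_half hy hi]
      omega

theorem add_half_mod_lt_half {L x : ℕ} (hL : 0 < L) :
    (x + L) % (2 * L) < L ↔ ¬ x % (2 * L) < L := by
  have := Nat.mod_lt x (show 0 < 2 * L by omega)
  rw [Nat.add_mod_eq_ite, Nat.mod_eq_of_lt (by omega : L < 2 * L)]
  split_ifs <;> omega

theorem succ_mod_lt_half {L x : ℕ} (hL : 0 < L) (h : (x + 1) % (2 * L) < L) :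
    x % (2 * L) < L ∨ x % (2 * L) = 2 * L - 1 := by
  have := Nat.mod_lt x (show 0 < 2 * L by omega)
  rw [Nat.add_mod_eq_ite, Nat.mod_eq_of_lt (by omega : 1 < 2 * L)] at h
  split_ifs at h <;> omega

variable {n : ℕ} (L : ℕ) (g : (Fin n → Bool) → ℕ)

/-- The vertices of the cube that the labelling `g` places on the `i`-th half of the cycle of
length `2 * L`. -/
def halfTurn (i : ℕ) : Finset (Fin n → Bool) :=
  Finset.univ.filter fun x => (g x + i) % (2 * L) < L

variable {L} {g}

@[simp]
theorem mem_halfTurn {i : ℕ} {x : Fin n → Bool} :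
    x ∈ halfTurn L g i ↔ (g x + i) % (2 * L) < L := by
  simp [halfTurn]

theorem halfTurn_add_half (hL : 0 < L) (i : ℕ) : halfTurn L g (i + L) = (halfTurn L g i)ᶜ := by
  ext x
  rw [Finset.mem_compl, mem_halfTurn, mem_halfTurn, ← add_assoc, add_half_mod_lt_half hL]

theorem edgeBoundary_compl (S : Finset (Fin n → Bool)) : edgeBoundary Sᶜ = edgeBoundary S := by
  simp only [edgeBoundary, Finset.mem_compl, not_iff_not]

theorem card_halfTurn (hg : Function.Injective g) (hlt : ∀ x, g x < 2 * L) (hn : 2 ^ n = 2 * L)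
    (i : ℕ) : (halfTurn L g i).card = L := by
  have himg : Finset.univ.image g = Finset.Ico 0 (0 + 2 * L) := by
    refine Finset.eq_of_subset_of_card_le ?_ ?_
    · intro y hy
      obtain ⟨x, -, rfl⟩ := Finset.mem_image.1 hy
      simpa using hlt x
    · rw [Finset.card_image_of_injective _ hg]
      simp [hn]
  have hL : 0 < L := by have : 0 < 2 ^ n := by positivity
                        omega
  have hper : Function.Periodic (fun v => (v + i) % (2 * L) < L) (2 * L) := by
    intro v
    simp only [show v + 2 * L + i = v + i + 2 * L by ring, Nat.add_mod_right]
  have hper' : Function.Periodic (fun v => v % (2 * L) < L) (2 * L) := by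
    intro v
    simp only [Nat.add_mod_right]
  have h1 : (halfTurn L g i).card =
      ((Finset.Ico 0 (0 + 2 * L)).filter fun v => (v + i) % (2 * L) < L).card := by
    rw [← himg, Finset.filter_image, Finset.card_image_of_injective _ hg, halfTurn]
  have h2 : ((Finset.Ico 0 (0 + 2 * L)).filter fun v => (v + i) % (2 * L) < L).card =
      ((Finset.Ico i (i + 2 * L)).filter fun v => v % (2 * L) < L).card := by
    rw [show Finset.Ico i (i + 2 * L) = (Finset.Ico 0 (0 + 2 * L)).image (· + i) by
      rw [Finset.image_add_right_Ico]; congr 1 <;> ring]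
    rw [Finset.filter_image, Finset.card_image_of_injective _ (add_left_injective i)]
  have h3 : (Finset.Ico 0 (0 + 2 * L)).filter (fun v => v % (2 * L) < L) = Finset.range L := by
    ext v
    simp only [Finset.mem_filter, Finset.mem_Ico, Finset.mem_range]
    constructor
    · rintro ⟨h, h'⟩
      rwa [Nat.mod_eq_of_lt (by omega)] at h'
    · intro h
      rw [Nat.mod_eq_of_lt (by omega)]
      omega
  rw [h1, h2, Nat.filter_Ico_card_eq_of_periodic i _ _ hper',
    ← Nat.filter_Ico_card_eq_of_periodic 0 _ _ hper', h3, Finset.card_range]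

theorem card_filter_halfTurn_succ_le (hg : Function.Injective g) (hlt : ∀ x, g x < 2 * L)
    (P : (Fin n → Bool) → Prop) [DecidablePred P] (i : ℕ) :
    ((halfTurn L g (i + 1)).filter P).card ≤ ((halfTurn L g i).filter P).card + 1 := by
  have hL : 0 < L := by have := hlt fun _ => false
                        omega
  have key : ((halfTurn L g (i + 1)).filter P \ (halfTurn L g i).filter P).card ≤ 1 := by
    have hmod : ∀ x ∈ (halfTurn L g (i + 1)).filter P \ (halfTurn L g i).filter P,
        (g x + i) % (2 * L) = 2 * L - 1 := by
      intro x hx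
      simp only [Finset.mem_sdiff, Finset.mem_filter, mem_halfTurn] at hx
      have := succ_mod_lt_half hL hx.1.1
      tauto
    rw [Finset.card_le_one]
    intro x hx y hy
    have h1 : g x + i ≡ g y + i [MOD 2 * L] := (hmod x hx).trans (hmod y hy).symm
    exact hg ((Nat.ModEq.add_right_cancel' i h1).eq_of_lt_of_lt (hlt x) (hlt y))
  have := Finset.le_card_sdiff ((halfTurn L g i).filter P) ((halfTurn L g (i + 1)).filter P)
  omega

/-- The circular wirelength of the cube: the lower bound for bijections onto the cycle. -/
theorem sum_cycDist_ge {m : ℕ} {g : (Fin (m + 2) → Bool) → ℕ} (hg : Function.Injective g)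
    (hlt : ∀ x, g x < 2 ^ (m + 2)) :
    3 * (2 ^ (m + 2)) ^ 2 ≤
      4 * ∑ x, ∑ j, cycDist (2 ^ (m + 2)) (g x) (g (flipBit j x)) + 4 * 2 ^ (m + 2) := by
  suffices h : 12 * (2 ^ m) ^ 2 ≤
      ∑ x, ∑ j, cycDist (2 ^ (m + 2)) (g x) (g (flipBit j x)) + 4 * 2 ^ m by
    have e1 : (2 ^ (m + 2)) ^ 2 = 16 * (2 ^ m) ^ 2 := by ring
    have e2 : 2 ^ (m + 2) = 4 * 2 ^ m := by ring
    omega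
  have e : (2 : ℕ) ^ (m + 2) = 2 * 2 ^ (m + 1) := by ring
  have hL : 0 < 2 ^ (m + 1) := by positivity
  rw [e] at hlt ⊢
  have hsum : ∑ x, ∑ j, cycDist (2 * 2 ^ (m + 1)) (g x) (g (flipBit j x)) =
      ∑ i ∈ Finset.range (2 ^ (m + 1)), edgeBoundary (halfTurn (2 ^ (m + 1)) g i) := by
    simp only [edgeBoundary, mem_halfTurn]
    rw [Finset.sum_comm (s := Finset.range _)]
    refine Finset.sum_congr rfl fun x _ => ?_
    rw [Finset.sum_comm (s := Finset.range _)]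
    exact Finset.sum_congr rfl fun j _ => cycDist_eq_sum (hlt _) (hlt _)
  have hcard := card_halfTurn hg hlt e
  rw [hsum]
  refine sum_boundary_path_ge
    (a := fun p i => ((halfTurn (2 ^ (m + 1)) g i).filter fun x => x p = true).card) ?_ ?_ ?_ ?_ ?_
  · intro i
    rw [halfTurn_add_half hL, edgeBoundary_compl]
  · intro p i
    have h1 : (Finset.univ.filter fun x : Fin (m + 2) → Bool => x p = true).card = 2 ^ (m + 1) := by
      rw [← card_facet_true]
      simp [facet]
    rw [halfTurn_add_half hL, ← h1, ← Finset.card_union_of_disjoint, ← Finset.filter_union]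
    · congr 1
      ext x
      simp only [Finset.mem_filter, Finset.mem_union, Finset.mem_compl, Finset.mem_univ]
      tauto
    · exact Finset.disjoint_filter_filter disjoint_compl_left
  · exact fun p i => card_filter_halfTurn_succ_le hg hlt _ i
  · exact fun p i => takagi_min_le_edgeBoundary p _ (hcard i)
  · exact fun i hi => exists_near_facet _ (hcard i) hi

end rotation

/-! ### Arrangements of fibres and maps onto shorter cycles -/

section arrangement

theorem card_mul_pred_le_two_mul_sum {α : Type*} (T : Finset α) {r : α → ℤ}
    (hr : Set.InjOn r T) (h0 : ∀ x ∈ T, 0 ≤ r x) :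
    (T.card : ℤ) * (T.card - 1) ≤ 2 * ∑ x ∈ T, r x := by
  have h1 := Finset.sum_range_le_sum (s := T.image r) (c := 0) (by simpa using h0)
  rw [Finset.card_image_of_injOn hr, Finset.sum_image hr] at h1
  have h2 : ∀ k : ℕ, 2 * ∑ i ∈ Finset.range k, (0 + (i : ℤ)) = k * (k - 1) := by
    intro k
    induction k with
    | zero => simp
    | succ k ih =>
      rw [Finset.sum_range_succ, mul_add, ih]
      push_cast
      ring
  rw [← h2]
  linarith

/-- If two disjoint blocks of `s` and `t` consecutive positions are joined by a matching, then the
lengths of the edges of the matching add up to at most `s * t`. -/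
theorem sum_matching_le {α : Type*} (T : Finset α) {r₀ r₁ : α → ℕ} {s t : ℕ}
    (h₀ : Set.InjOn r₀ T) (h₁ : Set.InjOn r₁ T) (hs : ∀ x ∈ T, r₀ x < s) (ht : ∀ x ∈ T, r₁ x < t)
    (hTs : T.card ≤ s) (hTt : T.card ≤ t) :
    ∑ x ∈ T, Nat.dist (r₀ x) (s + r₁ x) ≤ s * t := by
  have e : ((∑ x ∈ T, Nat.dist (r₀ x) (s + r₁ x) : ℕ) : ℤ) =
      (T.card : ℤ) * (s + t - 1) - ∑ x ∈ T, (r₀ x : ℤ) - ∑ x ∈ T, ((t : ℤ) - 1 - r₁ x) := by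
    rw [← nsmul_eq_mul, ← Finset.sum_const, ← Finset.sum_sub_distrib, ← Finset.sum_sub_distrib,
      Nat.cast_sum]
    refine Finset.sum_congr rfl fun x hx => ?_
    have := hs x hx
    rw [Nat.dist]
    omega
  have i₀ := card_mul_pred_le_two_mul_sum T (r := fun x => (r₀ x : ℤ))
    (fun x hx y hy h => h₀ hx hy (by simpa using h)) fun x _ => by positivity
  have i₁ := card_mul_pred_le_two_mul_sum T (r := fun x => (t : ℤ) - 1 - r₁ x)
    (fun x hx y hy h => h₁ hx hy (by simpa using h)) fun x hx => by have := ht x hx; omega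
  zify at hTs hTt ⊢
  push_cast at e
  rw [e]
  nlinarith [mul_nonneg (sub_nonneg.2 hTs) (sub_nonneg.2 hTt)]

/-- Any set `S` of vertices of the cube can be arranged on a line so that the lengths of its
internal edges add up to at most `|S| (|S| - 1) / 2`. The two facets are arranged one after the
other. Subcubes attain equality. -/
theorem exists_arrangement {n : ℕ} (S : Finset (Fin n → Bool)) :
    ∃ r : (Fin n → Bool) → ℕ, Set.InjOn r S ∧ (∀ x ∈ S, r x < S.card) ∧
      ∑ x, ∑ j, (if x ∈ S ∧ flipBit j x ∈ S then Nat.dist (r x) (r (flipBit j x)) else 0) +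
        S.card ≤ S.card ^ 2 := by
  induction n with
  | zero =>
    refine ⟨fun _ => 0, fun x _ y _ _ => Subsingleton.elim x y,
      fun x hx => Finset.card_pos.2 ⟨x, hx⟩, ?_⟩
    simp
    exact Nat.le_self_pow two_ne_zero _
  | succ n ih =>
    obtain ⟨r₀, inj₀, lt₀, c₀⟩ := ih (facet 0 false S)
    obtain ⟨r₁, inj₁, lt₁, c₁⟩ := ih (facet 0 true S)
    have hcard := card_facet_add_card_facet 0 S
    set s := (facet 0 false S).card with hs
    set t := (facet 0 true S).card with ht
    let r : (Fin (n + 1) → Bool) → ℕ :=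
      fun x => if x 0 then s + r₁ (Fin.tail x) else r₀ (Fin.tail x)
    have hrf : ∀ y : Fin n → Bool, r (Fin.insertNth 0 false y) = r₀ y := fun y => by simp [r]
    have hrt : ∀ y : Fin n → Bool, r (Fin.insertNth 0 true y) = s + r₁ y := fun y => by simp [r]
    have hins : ∀ x : Fin (n + 1) → Bool, ∃ b, ∃ y : Fin n → Bool, x = Fin.insertNth 0 b y :=
      fun x => ⟨x 0, Fin.tail x, by simp⟩
    refine ⟨r, ?_, ?_, ?_⟩
    · intro x hx x' hx' h
      obtain ⟨b, y, rfl⟩ := hins x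
      obtain ⟨b', y', rfl⟩ := hins x'
      rw [Finset.mem_coe, ← mem_facet] at hx hx'
      cases b <;> cases b' <;> simp only [hrf, hrt] at h
      · rw [inj₀ hx hx' h]
      · have := lt₀ y hx
        omega
      · have := lt₀ y' hx'
        omega
      · rw [inj₁ hx hx' (by omega)]
    · intro x hx
      obtain ⟨b, y, rfl⟩ := hins x
      rw [← mem_facet] at hx
      cases b
      · have := lt₀ y hx
        rw [hrf]
        omega
      · have := lt₁ y hx
        rw [hrt]
        omega
    · have hcross := sum_matching_le (facet 0 false S ∩ facet 0 true S) (r₀ := r₀) (r₁ := r₁)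
        (s := s) (t := t) (inj₀.mono (by simp)) (inj₁.mono (by simp))
        (fun x hx => lt₀ x (Finset.mem_inter.1 hx).1) (fun x hx => lt₁ x (Finset.mem_inter.1 hx).2)
        (Finset.card_le_card Finset.inter_subset_left)
        (Finset.card_le_card Finset.inter_subset_right)
      have e : facet 0 false S ∩ facet 0 true S =
          Finset.univ.filter fun y => y ∈ facet 0 false S ∧ y ∈ facet 0 true S := by
        ext; simp
      rw [e, Finset.sum_filter] at hcross
      rw [sum_flipBit_insertNth 0
        fun x x' => if x ∈ S ∧ x' ∈ S then Nat.dist (r x) (r x') else 0]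
      simp only [hrf, hrt, ← mem_facet, Nat.dist_add_add_left]
      rw [Finset.sum_add_distrib]
      have e2 : ∑ y, (if y ∈ facet 0 true S ∧ y ∈ facet 0 false S
          then Nat.dist (s + r₁ y) (r₀ y) else 0) =
          ∑ y, (if y ∈ facet 0 false S ∧ y ∈ facet 0 true S
          then Nat.dist (r₀ y) (s + r₁ y) else 0) :=
        Finset.sum_congr rfl fun y _ => by simp only [and_comm, Nat.dist_comm]
      rw [e2, ← hcard]
      nlinarith

end arrangement

section refinement

theorem cycDist_comm (N x y : ℕ) : cycDist N x y = cycDist N y x := by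
  rw [cycDist, cycDist, Nat.dist_comm]

theorem cycDist_self (N x : ℕ) : cycDist N x x = 0 := by
  simp [cycDist]

/-- Replace each vertex of the cycle of length `N` by a block of `F` vertices. The distance of two
points in different blocks, averaged over an arrangement inside the blocks and its reversal, is at
most `F` times the distance of the blocks. -/
theorem cycDist_block_add_le {N F a b p q : ℕ} (ha : a < N) (hb : b < N) (hp : p < F) (hq : q < F) :
    cycDist (N * F) (F * a + p) (F * b + q) +
      cycDist (N * F) (F * a + (F - 1 - p)) (F * b + (F - 1 - q)) ≤
      2 * (F * cycDist N a b) + 2 * (if a = b then Nat.dist p q else 0) := by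
  have main : ∀ a b p q, a < b → b < N → p < F → q < F →
      cycDist (N * F) (F * a + p) (F * b + q) +
      cycDist (N * F) (F * a + (F - 1 - p)) (F * b + (F - 1 - q)) ≤ 2 * (F * cycDist N a b) := by
    intro a b p q hab hb hp hq
    have h1 : F * (a + 1) ≤ F * b := Nat.mul_le_mul_left F hab
    have h2 : F * (b + 1) ≤ F * N := Nat.mul_le_mul_left F hb
    have e : Nat.dist a b = b - a := Nat.dist_eq_sub_of_le hab.le
    rw [cycDist.eq_1 N, e, ← Nat.mul_min_mul_left, Nat.mul_sub, Nat.mul_sub, Nat.mul_sub,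
      mul_comm N F, cycDist, cycDist, Nat.dist, Nat.dist]
    rw [mul_add, mul_one] at h1 h2
    omega
  rcases lt_trichotomy a b with h | rfl | h
  · exact (main a b p q h hb hp hq).trans (Nat.le_add_right _ _)
  · rw [cycDist_self, if_pos rfl, cycDist, cycDist, Nat.dist_add_add_left, Nat.dist_add_add_left,
      Nat.dist, Nat.dist]
    omega
  · rw [cycDist_comm, cycDist_comm (N * F) (F * a + (F - 1 - p)), cycDist_comm N a b]
    exact (main b a q p h ha hq hp).trans (Nat.le_add_right _ _)

/-- The lower bound for maps of the cube to the cycle of length `2 ^ n₁` whose fibres all have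
`2 ^ n₂` elements. The fibres are opened up to blocks of a cycle of length `2 ^ (n₁ + n₂)`, on
which `sum_cycDist_ge` applies. -/
theorem sum_cycDist_fiber_ge {n n₁ n₂ : ℕ} (hn : n₁ + n₂ = n) (h₁ : 2 ≤ n₁)
    {f : (Fin n → Bool) → ℕ} (hf : ∀ x, f x < 2 ^ n₁)
    (hfib : ∀ c < 2 ^ n₁, (Finset.univ.filter fun x => f x = c).card = 2 ^ n₂) :
    3 * 2 ^ n₂ * (2 ^ n₁) ^ 2 ≤
      4 * ∑ x, ∑ j, cycDist (2 ^ n₁) (f x) (f (flipBit j x)) + 4 * 2 ^ n₂ * 2 ^ n₁ := by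
  obtain ⟨m, rfl⟩ : ∃ m, n = m + 2 := ⟨n - 2, by omega⟩
  have hNF : 2 ^ (m + 2) = 2 ^ n₁ * 2 ^ n₂ := by rw [← hn, pow_add]
  have hF : 0 < 2 ^ n₂ := by positivity
  choose r hinj hlt hcost using
    fun c => exists_arrangement (Finset.univ.filter fun x : Fin (m + 2) → Bool => f x = c)
  simp only [Finset.mem_filter, Finset.mem_univ, true_and] at hlt hcost
  generalize 2 ^ n₁ = N at *
  generalize 2 ^ n₂ = F at *
  have hr : ∀ x, r (f x) x < F := fun x => hfib (f x) (hf x) ▸ hlt (f x) x rfl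
  have inj : ∀ q : (Fin (m + 2) → Bool) → ℕ, (∀ x, q x < F) →
      (∀ x y, f x = f y → q x = q y → x = y) → Function.Injective fun x => F * f x + q x := by
    intro q hq hfq x y h
    have hxy : f x = f y := by
      have := congrArg (· / F) h
      simpa [Nat.mul_add_div hF, Nat.div_eq_of_lt (hq _)] using this
    refine hfq x y hxy ?_
    simp only [hxy] at h
    omega
  have lt : ∀ q : (Fin (m + 2) → Bool) → ℕ, (∀ x, q x < F) → ∀ x, F * f x + q x < 2 ^ (m + 2) := by
    intro q hq x
    have h1 : F * (f x + 1) ≤ F * N := Nat.mul_le_mul_left F (hf x)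
    have := hq x
    rw [hNF, mul_comm N]
    rw [mul_add, mul_one] at h1
    omega
  have hq : ∀ x, F - 1 - r (f x) x < F := fun x => by omega
  have g₁ := sum_cycDist_ge (inj (fun x => r (f x) x) hr
    fun x y h h' => hinj (f x) (by simp) (by simp [h]) (h'.trans (by rw [h]))) (lt _ hr)
  have g₂ := sum_cycDist_ge (inj (fun x => F - 1 - r (f x) x) hq fun x y h h' =>
    hinj (f x) (by simp) (by simp [h]) (by
      have := hr x
      have := hr y
      rw [h] at *
      omega)) (lt _ hq)
  -- the total cost of the edges inside the fibres
  have hintra : ∑ x, ∑ j, (if f x = f (flipBit j x) then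
      Nat.dist (r (f x) x) (r (f (flipBit j x)) (flipBit j x)) else 0) + N * F ≤ N * F ^ 2 := by
    have h1 := Finset.sum_le_sum fun c (hc : c ∈ Finset.range N) =>
      (hfib c (Finset.mem_range.1 hc)) ▸ hcost c
    rw [Finset.sum_add_distrib, Finset.sum_const, Finset.sum_const, Finset.card_range, smul_eq_mul,
      smul_eq_mul, Finset.sum_comm] at h1
    refine le_trans (le_of_eq ?_) h1
    congr 1
    refine Finset.sum_congr rfl fun x _ => ?_
    rw [Finset.sum_comm]
    refine Finset.sum_congr rfl fun j _ => ?_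
    rw [Finset.sum_eq_single (f x)]
    · by_cases h : f x = f (flipBit j x)
      · rw [if_pos h, if_pos ⟨rfl, h.symm⟩, h]
      · rw [if_neg h, if_neg fun h' => h h'.2.symm]
    · exact fun c _ hc => if_neg fun h' => hc h'.1.symm
    · exact fun h => absurd (Finset.mem_range.2 (hf x)) h
  have hsum : ∑ x, ∑ j, cycDist (2 ^ (m + 2)) (F * f x + r (f x) x)
        (F * f (flipBit j x) + r (f (flipBit j x)) (flipBit j x)) +
      ∑ x, ∑ j, cycDist (2 ^ (m + 2)) (F * f x + (F - 1 - r (f x) x))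
        (F * f (flipBit j x) + (F - 1 - r (f (flipBit j x)) (flipBit j x))) ≤
      2 * (F * ∑ x, ∑ j, cycDist N (f x) (f (flipBit j x))) +
      2 * ∑ x, ∑ j, (if f x = f (flipBit j x) then
        Nat.dist (r (f x) x) (r (f (flipBit j x)) (flipBit j x)) else 0) := by
    simp only [Finset.mul_sum, ← Finset.sum_add_distrib]
    refine Finset.sum_le_sum fun x _ => Finset.sum_le_sum fun j _ => ?_
    rw [hNF]
    exact cycDist_block_add_le (hf _) (hf _) (hr _) (hr _)
  rw [hNF] at g₁ g₂ hsum
  refine Nat.le_of_mul_le_mul_left ?_ hF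
  nlinarith

end refinement

/-! ### The cost of the Gray code -/

section gray

theorem grayMap_succ_val {n : ℕ} (v : Fin (n + 1) → Bool) :
    (grayMap (n + 1) v : ℕ) =
      if v 0 then 2 ^ (n + 1) - 1 - (grayMap n (Fin.tail v)).val else
        (grayMap n (Fin.tail v)).val := by
  rw [grayMap]
  split_ifs
  · rw [Fin.val_rev, Fin.val_castLE]
    omega
  · rfl

theorem grayMap_insertNth_false {n : ℕ} (y : Fin n → Bool) :
    (grayMap (n + 1) (Fin.insertNth 0 false y) : ℕ) = grayMap n y := by
  simp [grayMap_succ_val]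

theorem grayMap_insertNth_true {n : ℕ} (y : Fin n → Bool) :
    (grayMap (n + 1) (Fin.insertNth 0 true y) : ℕ) = 2 ^ (n + 1) - 1 - (grayMap n y).val := by
  simp [grayMap_succ_val]

theorem grayMap_injective (n : ℕ) : Function.Injective (grayMap n) := by
  induction n with
  | zero => exact fun x y _ => Subsingleton.elim x y
  | succ n ih =>
    intro x y h
    have h' := congrArg Fin.val h
    have hx := (grayMap n (Fin.tail x)).isLt
    have hy := (grayMap n (Fin.tail y)).isLt
    have e : (2 : ℕ) ^ (n + 1) = 2 * 2 ^ n := by ring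
    rw [grayMap_succ_val, grayMap_succ_val] at h'
    have h0 : x 0 = y 0 := by
      cases hx0 : x 0 <;> cases hy0 : y 0 <;> simp [hx0, hy0] at h' ⊢ <;> omega
    have ht : Fin.tail x = Fin.tail y := by
      refine ih (Fin.ext ?_)
      rw [h0] at h'
      split_ifs at h' <;> omega
    rw [← Fin.cons_self_tail x, ← Fin.cons_self_tail y, h0, ht]

theorem sum_grayMap {n : ℕ} (F : ℕ → ℕ) :
    ∑ x, F (grayMap n x) = ∑ k ∈ Finset.range (2 ^ n), F k := by
  have hbij : Function.Bijective (grayMap n) :=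
    (Fintype.bijective_iff_injective_and_card _).2 ⟨grayMap_injective n, by simp⟩
  rw [hbij.sum_comp fun k : Fin (2 ^ n) => F k, Fin.sum_univ_eq_sum_range]

theorem dist_sub_sub {a p q : ℕ} (hp : p ≤ a) (hq : q ≤ a) :
    Nat.dist (a - p) (a - q) = Nat.dist p q := by
  simp only [Nat.dist]
  omega

theorem sum_range_odd (h : ℕ) : ∑ k ∈ Finset.range h, (2 * k + 1) = h ^ 2 := by
  induction h with
  | zero => rfl
  | succ h ih => rw [Finset.sum_range_succ, ih]; ring

/-- The cost of the Gray code as a linear arrangement (over ordered edges). -/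
theorem sum_dist_grayMap (n : ℕ) :
    ∑ x, ∑ j, Nat.dist (grayMap n x) (grayMap n (flipBit j x)) + 2 ^ n = (2 ^ n) ^ 2 := by
  induction n with
  | zero => simp
  | succ n ih =>
    have e : (2 : ℕ) ^ (n + 1) = 2 * 2 ^ n := by ring
    rw [sum_flipBit_insertNth 0
      fun x y : Fin (n + 1) → Bool => Nat.dist (grayMap (n + 1) x) (grayMap (n + 1) y)]
    simp only [grayMap_insertNth_false, grayMap_insertNth_true]
    have h1 : ∀ y z : Fin n → Bool, Nat.dist (2 ^ (n + 1) - 1 - grayMap n y)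
        (2 ^ (n + 1) - 1 - grayMap n z) = Nat.dist (grayMap n y) (grayMap n z) := fun y z =>
      dist_sub_sub (by have := (grayMap n y).isLt; omega) (by have := (grayMap n z).isLt; omega)
    have h2 : ∑ y, (Nat.dist (grayMap n y) (2 ^ (n + 1) - 1 - grayMap n y) +
        Nat.dist (2 ^ (n + 1) - 1 - grayMap n y) (grayMap n y)) = 2 * (2 ^ n) ^ 2 := by
      rw [sum_grayMap fun k => Nat.dist k (2 ^ (n + 1) - 1 - k) +
        Nat.dist (2 ^ (n + 1) - 1 - k) k, ← sum_range_odd, ← Finset.sum_range_reflect,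
        Finset.mul_sum]
      refine Finset.sum_congr rfl fun k hk => ?_
      rw [Finset.mem_range] at hk
      simp only [Nat.dist]
      omega
    rw [h2]
    simp only [h1]
    rw [e]
    nlinarith

theorem sum_min_odd (h : ℕ) :
    ∑ k ∈ Finset.range (2 * h), min (2 * k + 1) (4 * h - (2 * k + 1)) = 2 * h ^ 2 := by
  rw [two_mul h, Finset.sum_range_add, ← Finset.sum_range_reflect (fun x =>
    min (2 * (h + x) + 1) (4 * h - (2 * (h + x) + 1))), ← Finset.sum_add_distrib, ← sum_range_odd,
    Finset.mul_sum]
  refine Finset.sum_congr rfl fun k hk => ?_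
  rw [Finset.mem_range] at hk
  omega

/-- The cost of the Gray code on the cycle (over ordered edges). -/
theorem sum_cycDist_grayMap (m : ℕ) :
    ∑ x, ∑ j, cycDist (2 ^ (m + 2)) (grayMap (m + 2) x) (grayMap (m + 2) (flipBit j x)) +
      4 * 2 ^ m = 12 * (2 ^ m) ^ 2 := by
  have e1 : (2 : ℕ) ^ (m + 1) = 2 * 2 ^ m := by ring
  have e2 : (2 : ℕ) ^ (m + 1 + 1) = 4 * 2 ^ m := by ring
  have e3 : (2 : ℕ) ^ (m + 2) = 4 * 2 ^ m := by ring
  have e4 : ((2 : ℕ) ^ (m + 1)) ^ 2 = 4 * (2 ^ m) ^ 2 := by ring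
  rw [sum_flipBit_insertNth 0
    fun x y : Fin (m + 2) → Bool => cycDist (2 ^ (m + 2)) (grayMap (m + 2) x) (grayMap (m + 2) y)]
  simp only [grayMap_insertNth_false, grayMap_insertNth_true]
  have h0 : ∀ y z : Fin (m + 1) → Bool, cycDist (2 ^ (m + 2)) (grayMap (m + 1) y)
      (grayMap (m + 1) z) = Nat.dist (grayMap (m + 1) y) (grayMap (m + 1) z) := fun y z => by
    have := (grayMap (m + 1) y).isLt
    have := (grayMap (m + 1) z).isLt
    simp only [cycDist, Nat.dist]
    omega
  have h1 : ∀ y z : Fin (m + 1) → Bool,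
      cycDist (2 ^ (m + 2)) (2 ^ (m + 1 + 1) - 1 - grayMap (m + 1) y)
      (2 ^ (m + 1 + 1) - 1 - grayMap (m + 1) z) =
        Nat.dist (grayMap (m + 1) y) (grayMap (m + 1) z) := fun y z => by
    have := (grayMap (m + 1) y).isLt
    have := (grayMap (m + 1) z).isLt
    simp only [cycDist, Nat.dist]
    omega
  have h2 : ∑ y,
      (cycDist (2 ^ (m + 2)) (grayMap (m + 1) y) (2 ^ (m + 1 + 1) - 1 - grayMap (m + 1) y) +
      cycDist (2 ^ (m + 2)) (2 ^ (m + 1 + 1) - 1 - grayMap (m + 1) y) (grayMap (m + 1) y)) =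
        4 * (2 ^ m) ^ 2 := by
    rw [sum_grayMap fun k => cycDist (2 ^ (m + 2)) k (2 ^ (m + 1 + 1) - 1 - k) +
      cycDist (2 ^ (m + 2)) (2 ^ (m + 1 + 1) - 1 - k) k, e1,
      show 4 * (2 ^ m) ^ 2 = 2 * (2 * (2 ^ m) ^ 2) by ring, ← sum_min_odd, Finset.mul_sum]
    refine Finset.sum_congr rfl fun k hk => ?_
    rw [Finset.mem_range] at hk
    simp only [cycDist, Nat.dist]
    omega
  have h3 := sum_dist_grayMap (m + 1)
  simp only [h0, h1, h2]
  omega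

/-- Summing over the ordered edges a cost that depends on the first block of coordinates only, and
vanishes on edges in the directions of the last block. -/
theorem sum_flipBit_castAdd {n₁ n₂ : ℕ} (c : (Fin n₁ → Bool) → (Fin n₁ → Bool) → ℕ)
    (hc : ∀ x, c x x = 0) :
    ∑ v : Fin (n₁ + n₂) → Bool, ∑ j, c (fun i => v (Fin.castAdd n₂ i))
      (fun i => flipBit j v (Fin.castAdd n₂ i)) = 2 ^ n₂ * ∑ x, ∑ j, c x (flipBit j x) := by
  rw [← (Fin.appendEquiv n₁ n₂).sum_comp, Fintype.sum_prod_type_right]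
  simp only [Fin.sum_univ_add]
  have h1 : ∀ (x : Fin n₁ → Bool) (y : Fin n₂ → Bool),
      (fun i => Fin.appendEquiv n₁ n₂ (x, y) (Fin.castAdd n₂ i)) = x := by
    intro x y
    ext i
    simp [Fin.appendEquiv]
  have h2 : ∀ (x : Fin n₁ → Bool) (y : Fin n₂ → Bool) (j : Fin n₁),
      (fun i => flipBit (Fin.castAdd n₂ j) (Fin.appendEquiv n₁ n₂ (x, y)) (Fin.castAdd n₂ i)) =
        flipBit j x := by
    intro x y j
    ext i
    by_cases h : i = j
    · subst h
      simp [Fin.appendEquiv]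
    · rw [flipBit_ne h, flipBit_ne (by simpa [Fin.ext_iff] using h)]
      simp [Fin.appendEquiv]
  have h3 : ∀ (x : Fin n₁ → Bool) (y : Fin n₂ → Bool) (j : Fin n₂),
      (fun i => flipBit (Fin.natAdd n₁ j) (Fin.appendEquiv n₁ n₂ (x, y)) (Fin.castAdd n₂ i)) =
        x := by
    intro x y j
    ext i
    rw [flipBit_ne (by simp [Fin.ext_iff]; omega)]
    simp [Fin.appendEquiv]
  simp only [h1, h2, h3, hc, Finset.sum_const_zero, add_zero, Finset.sum_const, smul_eq_mul]
  simp

/-- The counterpart of `sum_flipBit_castAdd` for the last block of coordinates. -/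
theorem sum_flipBit_natAdd {n₁ n₂ : ℕ} (c : (Fin n₂ → Bool) → (Fin n₂ → Bool) → ℕ)
    (hc : ∀ x, c x x = 0) :
    ∑ v : Fin (n₁ + n₂) → Bool, ∑ j, c (fun i => v (Fin.natAdd n₁ i))
      (fun i => flipBit j v (Fin.natAdd n₁ i)) = 2 ^ n₁ * ∑ x, ∑ j, c x (flipBit j x) := by
  rw [← (Fin.appendEquiv n₁ n₂).sum_comp, Fintype.sum_prod_type]
  simp only [Fin.sum_univ_add]
  have h1 : ∀ (x : Fin n₁ → Bool) (y : Fin n₂ → Bool),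
      (fun i => Fin.appendEquiv n₁ n₂ (x, y) (Fin.natAdd n₁ i)) = y := by
    intro x y
    ext i
    simp [Fin.appendEquiv]
  have h2 : ∀ (x : Fin n₁ → Bool) (y : Fin n₂ → Bool) (j : Fin n₂),
      (fun i => flipBit (Fin.natAdd n₁ j) (Fin.appendEquiv n₁ n₂ (x, y)) (Fin.natAdd n₁ i)) =
        flipBit j y := by
    intro x y j
    ext i
    by_cases h : i = j
    · subst h
      simp [Fin.appendEquiv]
    · rw [flipBit_ne h, flipBit_ne (by simpa [Fin.ext_iff] using h)]
      simp [Fin.appendEquiv]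
  have h3 : ∀ (x : Fin n₁ → Bool) (y : Fin n₂ → Bool) (j : Fin n₁),
      (fun i => flipBit (Fin.castAdd n₂ j) (Fin.appendEquiv n₁ n₂ (x, y)) (Fin.natAdd n₁ i)) =
        y := by
    intro x y j
    ext i
    rw [flipBit_ne (by simp [Fin.ext_iff]; omega)]
    simp [Fin.appendEquiv]
  simp only [h1, h2, h3, hc, Finset.sum_const_zero, zero_add, Finset.sum_const, smul_eq_mul]
  simp

theorem grayMap₂_injective (n₁ n₂ : ℕ) : Function.Injective (grayMap₂ n₁ n₂) := by
  intro v w h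
  rw [grayMap₂, grayMap₂, Prod.mk.injEq] at h
  have h1 := grayMap_injective _ h.1
  have h2 := grayMap_injective _ h.2
  ext i
  refine Fin.addCases (fun i => ?_) (fun i => ?_) i
  · rw [congrFun h1 i]
  · rw [congrFun h2 i]

end gray

/-! ### Distances in cycles and tori -/

section graphs

theorem cycleGraph_adj_of_succ_eq {N : ℕ} {u v : Fin N} (h : (u : ℕ) + 1 = v) :
    (SimpleGraph.cycleGraph N).Adj u v := by
  rw [SimpleGraph.cycleGraph_adj']
  right
  have := v.isLt
  rw [Fin.val_sub, show N - u + v = 1 + N by omega, Nat.add_mod_right, Nat.mod_eq_of_lt (by omega)]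

theorem cycleGraph_dist_le {N : ℕ} (x y : Fin N) :
    (SimpleGraph.cycleGraph N).dist x y ≤ cycDist N x y := by
  obtain ⟨M, rfl⟩ : ∃ M, N = M + 1 := ⟨N - 1, by have := x.isLt; omega⟩
  have hconn := SimpleGraph.cycleGraph_connected (n := M)
  have line : ∀ k : ℕ, ∀ x y : Fin (M + 1), (x : ℕ) + k = y →
      (SimpleGraph.cycleGraph (M + 1)).dist x y ≤ k := by
    intro k
    induction k with
    | zero =>
      intro x y h
      rw [Fin.ext (a := x) (b := y) h, SimpleGraph.dist_self]
    | succ k ih =>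
      intro x y h
      have hz : (x : ℕ) + k < M + 1 := by have := y.isLt; omega
      have h1 := ih x ⟨x + k, hz⟩ rfl
      have h2 := SimpleGraph.dist_eq_one_iff_adj.2
        (cycleGraph_adj_of_succ_eq (u := ⟨x + k, hz⟩) (v := y) h)
      have := hconn.dist_triangle (u := x) (v := ⟨x + k, hz⟩) (w := y)
      omega
  have wrap : (SimpleGraph.cycleGraph (M + 1)).dist 0 (Fin.last M) ≤ 1 := by
    rcases M.eq_zero_or_pos with rfl | hM
    · rw [show Fin.last 0 = 0 from rfl, SimpleGraph.dist_self]
      omega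
    · refine (SimpleGraph.dist_eq_one_iff_adj.2 ?_).le
      rw [SimpleGraph.cycleGraph_adj']
      left
      rw [Fin.val_sub, Fin.val_last, Fin.val_zero, show M + 1 - M + 0 = 1 by omega,
        Nat.mod_eq_of_lt (by omega)]
  have main : ∀ x y : Fin (M + 1), x ≤ y →
      (SimpleGraph.cycleGraph (M + 1)).dist x y ≤ cycDist (M + 1) x y := by
    intro x y hxy
    have hxy' : (x : ℕ) ≤ y := hxy
    have := y.isLt
    rw [cycDist, Nat.dist_eq_sub_of_le hxy']
    refine le_min (line _ x y (by omega)) ?_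
    have h1 := line x 0 x (by simp)
    have h2 := line (M - y) y (Fin.last M) (by simp; omega)
    have h3 := hconn.dist_triangle (u := x) (v := 0) (w := y)
    have h4 := hconn.dist_triangle (u := 0) (v := Fin.last M) (w := y)
    rw [SimpleGraph.dist_comm (u := x) (v := 0)] at h3
    rw [SimpleGraph.dist_comm (u := Fin.last M) (v := y)] at h4
    omega
  rcases le_total x y with h | h
  · exact main x y h
  · rw [SimpleGraph.dist_comm, cycDist_comm]
    exact main y x h

theorem cycDist_le_of_adj {N : ℕ} {x y z : Fin N} (h : (SimpleGraph.cycleGraph N).Adj x y) :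
    cycDist N x z ≤ cycDist N y z + 1 := by
  rw [SimpleGraph.cycleGraph_adj', Fin.val_sub, Fin.val_sub] at h
  have hx := x.isLt
  have hy := y.isLt
  have hz := z.isLt
  have key : ∀ a b : ℕ, a < N → b < N → (N - b + a) % N = 1 →
      (a = b + 1 ∨ a + N = b + 1) := by
    intro a b ha hb hab
    rcases le_or_gt b a with h | h
    · rw [show N - b + a = a - b + N by omega, Nat.add_mod_right,
        Nat.mod_eq_of_lt (by omega)] at hab
      omega
    · rw [Nat.mod_eq_of_lt (by omega)] at hab
      omega
  simp only [cycDist, Nat.dist]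
  rcases h with h | h
  · rcases key _ _ hx hy h with h | h <;> omega
  · rcases key _ _ hy hx h with h | h <;> omega

theorem cycleGraph_dist {N : ℕ} (x y : Fin N) :
    (SimpleGraph.cycleGraph N).dist x y = cycDist N x y := by
  refine le_antisymm (cycleGraph_dist_le x y) ?_
  obtain ⟨M, rfl⟩ : ∃ M, N = M + 1 := ⟨N - 1, by have := x.isLt; omega⟩
  obtain ⟨p, hp⟩ := (SimpleGraph.cycleGraph_connected (n := M)).exists_walk_length_eq_dist x y
  rw [← hp]
  clear hp
  induction p with
  | nil => simp [cycDist_self]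
  | cons h p ih =>
    rw [SimpleGraph.Walk.length_cons]
    exact (cycDist_le_of_adj h).trans (Nat.add_le_add_right ih 1)

theorem torus_connected (n₁ n₂ : ℕ) : (torus (2 ^ n₁) (2 ^ n₂)).Connected := by
  have h : ∀ n : ℕ, (SimpleGraph.cycleGraph (2 ^ n)).Connected := by
    intro n
    rw [← Nat.sub_add_cancel (Nat.one_le_two_pow (n := n))]
    exact SimpleGraph.cycleGraph_connected
  exact (h n₁).boxProd (h n₂)

theorem torus_dist {n₁ n₂ : ℕ} (x y : Fin (2 ^ n₁) × Fin (2 ^ n₂)) :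
    (torus (2 ^ n₁) (2 ^ n₂)).dist x y =
      cycDist (2 ^ n₁) x.1 y.1 + cycDist (2 ^ n₂) x.2 y.2 := by
  have hconn := torus_connected n₁ n₂
  have h := SimpleGraph.edist_boxProd (G := SimpleGraph.cycleGraph (2 ^ n₁))
    (H := SimpleGraph.cycleGraph (2 ^ n₂)) x y
  rw [← (hconn.preconnected x y).coe_dist_eq_edist,
    ← (hconn.ofBoxProdLeft.preconnected x.1 y.1).coe_dist_eq_edist,
    ← (hconn.ofBoxProdRight.preconnected x.2 y.2).coe_dist_eq_edist] at h
  rw [← cycleGraph_dist, ← cycleGraph_dist]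
  exact_mod_cast h

/-! ### Wirelength -/

theorem hypercube_adj_flipBit {n : ℕ} (x : Fin n → Bool) (j : Fin n) :
    (hypercube n).Adj x (flipBit j x) := by
  change hammingDist x (flipBit j x) = 1
  rw [hammingDist, Finset.card_eq_one]
  refine ⟨j, ?_⟩
  ext i
  by_cases h : i = j
  · subst h
    simp
  · simp [h, flipBit_ne h]

theorem exists_flipBit_eq_of_adj {n : ℕ} {x y : Fin n → Bool} (h : (hypercube n).Adj x y) :
    ∃ j, y = flipBit j x := by
  change hammingDist x y = 1 at h
  rw [hammingDist, Finset.card_eq_one] at h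
  obtain ⟨j, hj⟩ := h
  refine ⟨j, ?_⟩
  ext i
  have hi := Finset.ext_iff.1 hj i
  simp only [Finset.mem_filter, Finset.mem_univ, true_and, Finset.mem_singleton] at hi
  by_cases h : i = j
  · subst h
    have := hi.2 rfl
    rw [flipBit_same]
    cases hx : x i <;> cases hy : y i <;> simp [hx, hy] at this ⊢
  · rw [flipBit_ne h]
    have h' : x i = y i := by
      by_contra h'
      exact h (hi.1 h')
    rw [h']

/-- Summing over ordered edges counts each edge of the cube twice. -/
theorem two_mul_sum_edgeFinset {n : ℕ} [Fintype (hypercube n).edgeSet]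
    (F : Sym2 (Fin n → Bool) → ℕ) :
    2 * ∑ e ∈ (hypercube n).edgeFinset, F e = ∑ x, ∑ j, F s(x, flipBit j x) := by
  have h1 : ∑ d : (hypercube n).Dart, F d.edge = 2 * ∑ e ∈ (hypercube n).edgeFinset, F e := by
    rw [← Finset.sum_fiberwise_of_maps_to (t := (hypercube n).edgeFinset)
      (g := SimpleGraph.Dart.edge) (by simp [SimpleGraph.Dart.edge_mem]), Finset.mul_sum]
    refine Finset.sum_congr rfl fun e he => ?_
    rw [Finset.sum_congr rfl (g := fun _ => F e)
      fun d hd => by rw [(Finset.mem_filter.1 hd).2], Finset.sum_const,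
      (hypercube n).dart_edge_fiber_card e (SimpleGraph.mem_edgeFinset.1 he), smul_eq_mul]
  rw [← h1, ← Fintype.sum_prod_type']
  symm
  let t : (Fin n → Bool) × Fin n → (hypercube n).Dart :=
    fun p => ⟨(p.1, flipBit p.2 p.1), hypercube_adj_flipBit p.1 p.2⟩
  have ht : Function.Bijective t := by
    constructor
    · rintro ⟨x, i⟩ ⟨y, j⟩ h
      have h' := congrArg SimpleGraph.Dart.toProd h
      simp only [t, Prod.mk.injEq] at h'
      obtain ⟨rfl, h2⟩ := h'
      by_cases hij : i = j
      · rw [hij]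
      · have := congrFun h2 i
        rw [flipBit_same, flipBit_ne hij] at this
        simp at this
    · rintro ⟨⟨x, y⟩, h⟩
      obtain ⟨j, hj⟩ := exists_flipBit_eq_of_adj h
      change y = flipBit j x at hj
      subst hj
      exact ⟨(x, j), rfl⟩
  exact ht.sum_comp fun d => F d.edge

namespace GraphEmbedding

theorem edgeLength_mk {V W : Type*} {G : SimpleGraph V} {H : SimpleGraph W}
    (E : GraphEmbedding G H) {u v : V} (h : G.Adj u v) :
    E.edgeLength s(u, v) = (E.path h).1.length := by
  rw [edgeLength, Sym2.lift_mk]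
  exact dif_pos h

/-- Every injective map into a connected graph extends to an embedding along shortest paths. An
auxiliary linear order on the vertices orients each edge, so that the chosen path is the same in
both directions. -/
theorem exists_usesShortestPaths {V W : Type*} {G : SimpleGraph V} {H : SimpleGraph W}
    (hH : H.Connected) {f : V → W} (hf : Function.Injective f) :
    ∃ E : GraphEmbedding G H, E.toFun = f ∧ E.UsesShortestPaths := by
  classical
  choose p hp hlen using fun u v : V => hH.exists_path_of_dist (f u) (f v)
  let _ : LinearOrder V := WellOrderingRel.isWellOrder.linearOrder
  refine ⟨⟨f, hf, fun {u v} _ => if u < v then ⟨p u v, hp u v⟩ else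
    SimpleGraph.Path.reverse (⟨p v u, hp v u⟩ : H.Path (f v) (f u)), ?_⟩, rfl, ?_⟩
  · intro u v h
    rcases lt_trichotomy u v with h' | h' | h'
    · rw [if_pos h', if_neg h'.not_gt]
    · exact absurd h' h.ne
    · rw [if_pos h', if_neg h'.not_gt]
      exact Subtype.ext (by simp)
  · intro u v h
    dsimp only
    split_ifs
    · exact hlen u v
    · rw [SimpleGraph.Path.reverse_coe, SimpleGraph.Walk.length_reverse, hlen,
        SimpleGraph.dist_comm]

variable {n₁ n₂ : ℕ} (E : GraphEmbedding (hypercube (n₁ + n₂)) (torus (2 ^ n₁) (2 ^ n₂)))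

/-- The wirelength is at least the sum of the costs of the two coordinates of the vertex map. -/
theorem sum_cycDist_le_two_mul_wirelength :
    ∑ x, ∑ j, cycDist (2 ^ n₁) (E.toFun x).1 (E.toFun (flipBit j x)).1 +
      ∑ x, ∑ j, cycDist (2 ^ n₂) (E.toFun x).2 (E.toFun (flipBit j x)).2 ≤ 2 * E.wirelength := by
  rw [wirelength, two_mul_sum_edgeFinset]
  simp only [← Finset.sum_add_distrib]
  refine Finset.sum_le_sum fun x _ => Finset.sum_le_sum fun j _ => ?_
  rw [edgeLength_mk E (hypercube_adj_flipBit x j), ← torus_dist]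
  exact SimpleGraph.dist_le _

theorem two_mul_wirelength_eq (hE : E.UsesShortestPaths) :
    2 * E.wirelength = ∑ x, ∑ j, cycDist (2 ^ n₁) (E.toFun x).1 (E.toFun (flipBit j x)).1 +
      ∑ x, ∑ j, cycDist (2 ^ n₂) (E.toFun x).2 (E.toFun (flipBit j x)).2 := by
  rw [wirelength, two_mul_sum_edgeFinset]
  simp only [← Finset.sum_add_distrib]
  refine Finset.sum_congr rfl fun x _ => Finset.sum_congr rfl fun j _ => ?_
  rw [edgeLength_mk E (hypercube_adj_flipBit x j), ← torus_dist]
  exact hE _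

/-- A bijection onto the torus has coordinates with fibres of constant size. -/
theorem card_fiber :
    (∀ c < 2 ^ n₁, (Finset.univ.filter fun x => ((E.toFun x).1 : ℕ) = c).card = 2 ^ n₂) ∧
      ∀ c < 2 ^ n₂, (Finset.univ.filter fun x => ((E.toFun x).2 : ℕ) = c).card = 2 ^ n₁ := by
  have hbij : Function.Bijective E.toFun :=
    (Fintype.bijective_iff_injective_and_card _).2 ⟨E.injective, by simp [pow_add]⟩
  constructor <;> intro c hc
  · rw [Finset.card_equiv (Equiv.ofBijective _ hbij)
      (t := {(⟨c, hc⟩ : Fin (2 ^ n₁))} ×ˢ (Finset.univ : Finset (Fin (2 ^ n₂))))]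
    · simp
    · intro x
      simp only [Finset.mem_filter, Finset.mem_univ, true_and, and_true, Finset.mem_product,
        Finset.mem_singleton, Equiv.ofBijective_apply, Fin.ext_iff]
  · rw [Finset.card_equiv (Equiv.ofBijective _ hbij)
      (t := (Finset.univ : Finset (Fin (2 ^ n₁))) ×ˢ {(⟨c, hc⟩ : Fin (2 ^ n₂))})]
    · simp
    · intro x
      simp only [Finset.mem_filter, Finset.mem_univ, true_and, Finset.mem_product,
        Finset.mem_singleton, Equiv.ofBijective_apply, Fin.ext_iff]

theorem wirelength_ge (h₁ : 2 ≤ n₁) (h₂ : 2 ≤ n₂) :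
    3 * 2 ^ n₂ * (2 ^ n₁) ^ 2 + 3 * 2 ^ n₁ * (2 ^ n₂) ^ 2 ≤
      8 * E.wirelength + 8 * (2 ^ n₁ * 2 ^ n₂) := by
  have a₁ := sum_cycDist_fiber_ge rfl h₁ (fun x => (E.toFun x).1.isLt) E.card_fiber.1
  have a₂ := sum_cycDist_fiber_ge (add_comm n₂ n₁) h₂ (fun x => (E.toFun x).2.isLt) E.card_fiber.2
  have := E.sum_cycDist_le_two_mul_wirelength
  nlinarith

theorem wirelength_grayMap₂ (h₁ : 2 ≤ n₁) (h₂ : 2 ≤ n₂) (hf : E.toFun = grayMap₂ n₁ n₂)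
    (hE : E.UsesShortestPaths) :
    8 * E.wirelength + 8 * (2 ^ n₁ * 2 ^ n₂) =
      3 * 2 ^ n₂ * (2 ^ n₁) ^ 2 + 3 * 2 ^ n₁ * (2 ^ n₂) ^ 2 := by
  have h := E.two_mul_wirelength_eq hE
  rw [hf] at h
  simp only [grayMap₂] at h
  rw [sum_flipBit_castAdd (fun x y => cycDist (2 ^ n₁) (grayMap n₁ x) (grayMap n₁ y))
      (fun x => cycDist_self _ _),
    sum_flipBit_natAdd (fun x y => cycDist (2 ^ n₂) (grayMap n₂ x) (grayMap n₂ y))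
      (fun x => cycDist_self _ _)] at h
  obtain ⟨k₁, rfl⟩ : ∃ k, n₁ = k + 2 := ⟨n₁ - 2, by omega⟩
  obtain ⟨k₂, rfl⟩ : ∃ k, n₂ = k + 2 := ⟨n₂ - 2, by omega⟩
  have a₁ := congrArg (2 ^ (k₂ + 2) * ·) (sum_cycDist_grayMap k₁)
  have a₂ := congrArg (2 ^ (k₁ + 2) * ·) (sum_cycDist_grayMap k₂)
  simp only [mul_add] at a₁ a₂
  ring_nf at h a₁ a₂ ⊢
  linarith

end GraphEmbedding

theorem eight_mul_wirelength_value {n₁ n₂ : ℕ} (h₁ : 2 ≤ n₁) (h₂ : 2 ≤ n₂) :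
    8 * ((2 : ℤ) ^ n₂ * (3 * 2 ^ (2 * n₁ - 3) - 2 ^ (n₁ - 1)) +
      2 ^ n₁ * (3 * 2 ^ (2 * n₂ - 3) - 2 ^ (n₂ - 1))) + 8 * (2 ^ n₁ * 2 ^ n₂) =
      3 * 2 ^ n₂ * (2 ^ n₁) ^ 2 + 3 * 2 ^ n₁ * (2 ^ n₂) ^ 2 := by
  obtain ⟨k₁, rfl⟩ : ∃ k, n₁ = k + 2 := ⟨n₁ - 2, by omega⟩
  obtain ⟨k₂, rfl⟩ : ∃ k, n₂ = k + 2 := ⟨n₂ - 2, by omega⟩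
  rw [show 2 * (k₁ + 2) - 3 = k₁ + k₁ + 1 by omega, show 2 * (k₂ + 2) - 3 = k₂ + k₂ + 1 by omega,
    show k₁ + 2 - 1 = k₁ + 1 by omega, show k₂ + 2 - 1 = k₂ + 1 by omega]
  ring

end graphs

theorem theorem1 (n₁ n₂ : ℕ) (h₁ : 2 ≤ n₁) (h₂ : 2 ≤ n₂) :
    -- the minimum wirelength over all embeddings
    IsLeast
      (Set.range fun E : GraphEmbedding (hypercube (n₁ + n₂)) (torus (2 ^ n₁) (2 ^ n₂)) =>
        (E.wirelength : ℤ))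
      (2 ^ n₂ * (3 * 2 ^ (2 * n₁ - 3) - 2 ^ (n₁ - 1)) +
        2 ^ n₁ * (3 * 2 ^ (2 * n₂ - 3) - 2 ^ (n₂ - 1))) ∧
    -- the Gray code embedding exists (with shortest paths) and attains the minimum
    (∃ E : GraphEmbedding (hypercube (n₁ + n₂)) (torus (2 ^ n₁) (2 ^ n₂)),
      E.toFun = grayMap₂ n₁ n₂ ∧ E.UsesShortestPaths) ∧
    ∀ E : GraphEmbedding (hypercube (n₁ + n₂)) (torus (2 ^ n₁) (2 ^ n₂)),
      E.toFun = grayMap₂ n₁ n₂ → E.UsesShortestPaths →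
        (E.wirelength : ℤ) =
          2 ^ n₂ * (3 * 2 ^ (2 * n₁ - 3) - 2 ^ (n₁ - 1)) +
            2 ^ n₁ * (3 * 2 ^ (2 * n₂ - 3) - 2 ^ (n₂ - 1)) := by
  have hval := eight_mul_wirelength_value h₁ h₂
  have hgray : ∀ E : GraphEmbedding (hypercube (n₁ + n₂)) (torus (2 ^ n₁) (2 ^ n₂)),
      E.toFun = grayMap₂ n₁ n₂ → E.UsesShortestPaths →
        (E.wirelength : ℤ) =
          2 ^ n₂ * (3 * 2 ^ (2 * n₁ - 3) - 2 ^ (n₁ - 1)) +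
            2 ^ n₁ * (3 * 2 ^ (2 * n₂ - 3) - 2 ^ (n₂ - 1)) := by
    intro E hf hE
    have h := E.wirelength_grayMap₂ h₁ h₂ hf hE
    zify at h
    linarith
  obtain ⟨E₀, hf, hE⟩ := GraphEmbedding.exists_usesShortestPaths (G := hypercube (n₁ + n₂))
    (torus_connected n₁ n₂) (grayMap₂_injective n₁ n₂)
  refine ⟨⟨⟨E₀, hgray E₀ hf hE⟩, ?_⟩, ⟨E₀, hf, hE⟩, hgray⟩
  rintro _ ⟨E, rfl⟩
  have h := E.wirelength_ge h₁ h₂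
  zify at h
  dsimp only
  linarith
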